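/- Let $h>0$, let $A_0,A_1,D\in\mathbb R^{n\times n}$, and consider the neutral system $$\frac{\mathrm d}{\mathrm dt}\,[x(t)-Dx(t-h)]=A_0x(t)+A_1x(t-h),\qquad t\ge 0 .\tag{1}$$ For a piecewise continuously differentiable $\varphi:[-h,0]\to\mathbb R^n$, the solution $x(t,\varphi)$ is the piecewise continuous function with $x=\varphi$ on $[-h,0]$ such that $x(t)-Dx(t-h)$ is continuous for $t\ge 0$ and (1) holds except possibly at countably many points. System (1) is exponentially stable if there are $\gamma,\sigma>0$ with $\|x(t,\varphi)\|\le\gamma e^{-\sigma t}\sup_{\theta\in[-h,0]}\|\varphi(\theta)\|$ for all such $\varphi$ and all $t\ge0$. Let $W$ be a (symmetric) positive definite matrix and let $U:[-h,h]\to\mathbb R^{n\times n}$ be a delay Lyapunov matrix associated with $W$: $U$ is continuous, $U'(\theta)-U'(\theta-h)D=U(\theta)A_0+U(\theta-h)A_1$ for $\theta\in(0,h)$, $U^\top(\theta)=U(-\theta)$ for $\theta\in[-h,h]$, and $P-D^\top PD=-W$, where $P=\lim_{\theta\to0^+}(U'(\theta)-U'(-\theta))$. For $\xi\in\mathbb R^n$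 and $\varphi:[-h,0]\to\mathbb R^n$ put $$\begin{aligned}v(\xi,\varphi)=\;&\xi^\top U(0)\xi+2\xi^\top\!\int_{-h}^0\!\big(U^\top(h+\theta)A_1-U'^\top(h+\theta)D\big)\varphi(\theta)\,d\theta\\&+\int_{-h}^0\!\int_{-h}^0\!\varphi^\top(\theta_1)\big(A_1^\top U(\theta_1-\theta_2)A_1+2A_1^\top U'(\theta_1-\theta_2)D\big)\varphi(\theta_2)\,d\theta_2d\theta_1\\&-\int_{-h}^0\Big(\int_{-h}^{\theta_1}+\int_{\theta_1}^0\Big)\varphi^\top(\theta_1)D^\top U''(\theta_1-\theta_2)D\varphi(\theta_2)\,d\theta_2d\theta_1-\int_{-h}^0\varphi^\top(\theta)D^\top PD\varphi(\theta)\,d\theta,\end{aligned}$$ and $v_0(\varphi)=v(\varphi(0)-D\varphi(-h),\varphi)$. For $N\in\mathbb N$ let $\Theta_N^\top(\theta)=[I_n\ \ \theta I_n\ \cdots\ \theta^{N-1}I_n]$, and define the symmetric matrix $$\mathbf P_N=\begin{bmatrix}U(0)&J_1-J_2\\(J_1-J_2)^\top&J_3+J_4+J_4^\top-J_5-J_6\end{bmatrix}\in\mathbb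 R^{(n+nN)\times(n+nN)},$$ $$J_1=\int_{-h}^0U^\top(h+\theta)A_1\Theta_N^\top(\theta)\,d\theta,\quad J_2=\int_{-h}^0U'^\top(h+\theta)D\Theta_N^\top(\theta)\,d\theta,\quad J_6=\int_{-h}^0\Theta_N(\theta)D^\top PD\,\Theta_N^\top(\theta)\,d\theta,$$ $$J_3=\int_{-h}^0\!\int_{-h}^0\Theta_N(\theta_1)A_1^\top U(\theta_1-\theta_2)A_1\Theta_N^\top(\theta_2)\,d\theta_2d\theta_1,\quad J_4=\int_{-h}^0\!\int_{-h}^0\Theta_N(\theta_1)A_1^\top U'(\theta_1-\theta_2)D\,\Theta_N^\top(\theta_2)\,d\theta_2d\theta_1,$$ $$J_5=\int_{-h}^0\Big(\int_{-h}^{\theta_1}+\int_{\theta_1}^0\Big)\Theta_N(\theta_1)D^\top U''(\theta_1-\theta_2)D\,\Theta_N^\top(\theta_2)\,d\theta_2d\theta_1.$$ **Theorem.** If (1) is exponentially stable, then for every $N\in\mathbb N$ the matrix $\mathbf P_N$ is positive semidefinite. Moreover, $\mathbf P_N$, which is independent of the approximation, is the matrix of the quadratic form of every polynomial approximation of order $N$: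 let $p_0,\dots,p_{N-1}$ be real polynomials of degree less than $N$, $\mathcal Q=(\mathcal Q_0,\dots,\mathcal Q_{N-1})\in\mathbb R^{nN}$, $\varphi_N(\theta)=\sum_{j=0}^{N-1}p_j(\theta)\mathcal Q_j$, and let $\Phi_N\in\mathbb R^{nN}$ be the vector whose $k$-th block is $\sum_j [\theta^k]p_j\;\mathcal Q_j$. Then $\varphi_N(\theta)=\Theta_N^\top(\theta)\Phi_N$; with $\Xi=[(\varphi_N(0)-D\varphi_N(-h))^\top\ \ \Phi_N^\top]^\top$ one has $v_0(\varphi_N)=\Xi^\top\mathbf P_N\Xi$; and for every piecewise continuously differentiable $\varphi$ on $[-h,0]$, with $\Xi=[(\varphi(0)-D\varphi(-h))^\top\ \ \Phi_N^\top]^\top$, one has $v(\varphi(0)-D\varphi(-h),\varphi_N)=\Xi^\top\mathbf P_N\Xi$. -/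

import Mathlib

open Set Filter Topology Matrix MeasureTheory

namespace NeutralDelay

noncomputable section

/-- Piecewise continuous on `[a, b]`: continuous off finitely many points, with finite one-sided
limits everywhere (values at the finitely many exceptional points are arbitrary). -/
def IsPCOn {n : ℕ} (f : ℝ → Fin n → ℝ) (a b : ℝ) : Prop :=
  (∃ S : Finset ℝ, ∀ t ∈ Ioo a b, t ∉ S → ContinuousAt f t) ∧
  (∀ t ∈ Ico a b, ∃ l, Tendsto f (𝓝[>] t) (𝓝 l)) ∧
  (∀ t ∈ Ioc a b, ∃ l, Tendsto f (𝓝[<] t) (𝓝 l))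

/-- Piecewise continuously differentiable on `[a, b]`: `C¹` off finitely many points, where the
function and its derivative have finite one-sided limits everywhere. -/
def IsPC1On {n : ℕ} (f : ℝ → Fin n → ℝ) (a b : ℝ) : Prop :=
  (∃ S : Finset ℝ, ∀ t ∈ Ioo a b, t ∉ S → ContDiffAt ℝ 1 f t) ∧
  (∀ t ∈ Ico a b, (∃ l, Tendsto f (𝓝[>] t) (𝓝 l)) ∧ ∃ l, Tendsto (deriv f) (𝓝[>] t) (𝓝 l)) ∧
  (∀ t ∈ Ioc a b, (∃ l, Tendsto f (𝓝[<] t) (𝓝 l)) ∧ ∃ l, Tendsto (deriv f) (𝓝[<] t) (𝓝 l))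

/-- The Euclidean norm of a vector. -/
def eucl {n : ℕ} (v : Fin n → ℝ) : ℝ := ‖WithLp.toLp 2 v‖

/-- The uniform norm `sup_{θ ∈ [-h, 0]} ‖φ(θ)‖`. -/
def supNorm {n : ℕ} (h : ℝ) (φ : ℝ → Fin n → ℝ) : ℝ :=
  sSup ((fun θ => eucl (φ θ)) '' Icc (-h) 0)

/-- `x` is a solution, with initial function `φ` on `[-h, 0]`, of
`d/dt [x(t) - D x(t - h)] = A₀ x(t) + A₁ x(t - h)`: it is piecewise continuous, the difference
`x(t) - D x(t - h)` is continuous for `t ≥ 0`, and the equation holds for all `t > 0` except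
possibly a countable set of points. -/
structure IsSolution {n : ℕ} (h : ℝ) (A₀ A₁ D : Matrix (Fin n) (Fin n) ℝ)
    (φ x : ℝ → Fin n → ℝ) : Prop where
  initial : ∀ θ ∈ Icc (-h) 0, x θ = φ θ
  piecewise : ∀ T : ℝ, 0 < T → IsPCOn x (-h) T
  continuous_diff : ContinuousOn (fun t => x t - D *ᵥ x (t - h)) (Ici 0)
  equation : ∃ S : Set ℝ, S.Countable ∧ ∀ t : ℝ, 0 < t → t ∉ S →
    HasDerivAt (fun s => x s - D *ᵥ x (s - h)) (A₀ *ᵥ x t + A₁ *ᵥ x (t - h)) t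

/-- Exponential stability of the neutral system. -/
def ExpStable {n : ℕ} (h : ℝ) (A₀ A₁ D : Matrix (Fin n) (Fin n) ℝ) : Prop :=
  ∃ γ > 0, ∃ σ > 0, ∀ φ : ℝ → Fin n → ℝ, IsPC1On φ (-h) 0 →
    ∀ x : ℝ → Fin n → ℝ, IsSolution h A₀ A₁ D φ x →
      ∀ t : ℝ, 0 ≤ t → eucl (x t) ≤ γ * Real.exp (-σ * t) * supNorm h φ

/-- Entrywise derivative of a matrix function. -/
def mderiv {n : ℕ} (U : ℝ → Matrix (Fin n) (Fin n) ℝ) (θ : ℝ) : Matrix (Fin n) (Fin n) ℝ :=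
  Matrix.of fun i j => deriv (fun s => U s i j) θ

/-- `U` is a delay Lyapunov matrix on `[-h, h]` associated with `W`, and
`P = lim_{θ → 0+} (U'(θ) - U'(-θ))` is the jump of its derivative at `0`. -/
structure IsDelayLyapunovMatrix {n : ℕ} (h : ℝ) (A₀ A₁ D W : Matrix (Fin n) (Fin n) ℝ)
    (U : ℝ → Matrix (Fin n) (Fin n) ℝ) (P : Matrix (Fin n) (Fin n) ℝ) : Prop where
  continuousOn : ContinuousOn U (Icc (-h) h)
  differentiable : ∀ θ ∈ Ioo 0 h, ∀ i j, DifferentiableAt ℝ (fun s => U s i j) θ ∧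
    DifferentiableAt ℝ (fun s => U s i j) (θ - h)
  dynamic : ∀ θ ∈ Ioo 0 h,
    mderiv U θ - mderiv U (θ - h) * D = U θ * A₀ + U (θ - h) * A₁
  symmetry : ∀ θ ∈ Icc (-h) h, (U θ)ᵀ = U (-θ)
  jump : Tendsto (fun θ => mderiv U θ - mderiv U (-θ)) (𝓝[>] 0) (𝓝 P)
  algebraic : P - Dᵀ * P * D = -W

/-- The Lyapunov-Krasovskii functional, as a function of the vector `ξ`, which stands for
`φ(0) - D φ(-h)`, and of the function `φ` under the integrals. -/
def functional {n : ℕ} (h : ℝ) (A₁ D : Matrix (Fin n) (Fin n) ℝ)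
    (U : ℝ → Matrix (Fin n) (Fin n) ℝ) (P : Matrix (Fin n) (Fin n) ℝ)
    (ξ : Fin n → ℝ) (φ : ℝ → Fin n → ℝ) : ℝ :=
  ξ ⬝ᵥ U 0 *ᵥ ξ
  + 2 * (ξ ⬝ᵥ ∫ θ in (-h)..0, ((U (h + θ))ᵀ * A₁) *ᵥ φ θ)
  - 2 * (ξ ⬝ᵥ ∫ θ in (-h)..0, ((mderiv U (h + θ))ᵀ * D) *ᵥ φ θ)
  + (∫ θ₁ in (-h)..0, ∫ θ₂ in (-h)..0, φ θ₁ ⬝ᵥ (A₁ᵀ * U (θ₁ - θ₂) * A₁) *ᵥ φ θ₂)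
  + 2 * (∫ θ₁ in (-h)..0, ∫ θ₂ in (-h)..0,
      φ θ₁ ⬝ᵥ (A₁ᵀ * mderiv U (θ₁ - θ₂) * D) *ᵥ φ θ₂)
  + (-(∫ θ₁ in (-h)..0, ∫ θ₂ in (-h)..θ₁,
        φ θ₁ ⬝ᵥ (Dᵀ * mderiv (mderiv U) (θ₁ - θ₂) * D) *ᵥ φ θ₂)
      - ∫ θ₁ in (-h)..0, ∫ θ₂ in θ₁..0,
        φ θ₁ ⬝ᵥ (Dᵀ * mderiv (mderiv U) (θ₁ - θ₂) * D) *ᵥ φ θ₂)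
  - ∫ θ in (-h)..0, φ θ ⬝ᵥ (Dᵀ * P * D) *ᵥ φ θ

/-- The functional `v₀(φ)`. -/
def v0 {n : ℕ} (h : ℝ) (A₁ D : Matrix (Fin n) (Fin n) ℝ)
    (U : ℝ → Matrix (Fin n) (Fin n) ℝ) (P : Matrix (Fin n) (Fin n) ℝ)
    (φ : ℝ → Fin n → ℝ) : ℝ :=
  functional h A₁ D U P (φ 0 - D *ᵥ φ (-h)) φ

/-- `Θ_N(θ)ᵀ = [I, θ I, …, θ^{N-1} I]`; column `(k, j)` is the `j`-th column of block `k`. -/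
def thetaT (n N : ℕ) (θ : ℝ) : Matrix (Fin n) (Fin N × Fin n) ℝ :=
  Matrix.of fun i p => θ ^ (p.1 : ℕ) * (1 : Matrix (Fin n) (Fin n) ℝ) i p.2

/-- `Θ_N(θ)`. -/
def theta (n N : ℕ) (θ : ℝ) : Matrix (Fin N × Fin n) (Fin n) ℝ := (thetaT n N θ)ᵀ

/-- `P_N(θ)ᵀ = [p₀(θ) I, …, p_{N-1}(θ) I]` for polynomials `p₀, …, p_{N-1}`. -/
def polyT {n N : ℕ} (p : Fin N → Polynomial ℝ) (θ : ℝ) : Matrix (Fin n) (Fin N × Fin n) ℝ :=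
  Matrix.of fun i q => (p q.1).eval θ * (1 : Matrix (Fin n) (Fin n) ℝ) i q.2

/-- The polynomial approximation `φ_N(θ) = P_N(θ)ᵀ Q`. -/
def polyApprox {n N : ℕ} (p : Fin N → Polynomial ℝ) (Q : Fin N × Fin n → ℝ)
    (θ : ℝ) : Fin n → ℝ :=
  polyT p θ *ᵥ Q

/-- The monomial coefficients `Φ_N` of `φ_N`, obtained by expanding the polynomials `p_j`. -/
def monomialCoeffs {n N : ℕ} (p : Fin N → Polynomial ℝ) (Q : Fin N × Fin n → ℝ) :
    Fin N × Fin n → ℝ :=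
  fun q => ∑ j : Fin N, (p j).coeff (q.1 : ℕ) * Q (j, q.2)

/-- The vector `Ξ = [ξᵀ, Φᵀ]ᵀ`. -/
def Xi {n N : ℕ} (ξ : Fin n → ℝ) (Φ : Fin N × Fin n → ℝ) : Fin n ⊕ Fin N × Fin n → ℝ :=
  Sum.elim ξ Φ

/-- `J₁ = ∫ U(h+θ)ᵀ A₁ Θ_N(θ)ᵀ dθ`; matrix integrals are entrywise. -/
def J1 {n : ℕ} (N : ℕ) (h : ℝ) (A₁ : Matrix (Fin n) (Fin n) ℝ)
    (U : ℝ → Matrix (Fin n) (Fin n) ℝ) : Matrix (Fin n) (Fin N × Fin n) ℝ :=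
  Matrix.of fun i q => ∫ θ in (-h)..0, ((U (h + θ))ᵀ * A₁ * thetaT n N θ) i q

/-- `J₂ = ∫ U'(h+θ)ᵀ D Θ_N(θ)ᵀ dθ`. -/
def J2 {n : ℕ} (N : ℕ) (h : ℝ) (D : Matrix (Fin n) (Fin n) ℝ)
    (U : ℝ → Matrix (Fin n) (Fin n) ℝ) : Matrix (Fin n) (Fin N × Fin n) ℝ :=
  Matrix.of fun i q => ∫ θ in (-h)..0, ((mderiv U (h + θ))ᵀ * D * thetaT n N θ) i q

/-- `J₃ = ∫∫ Θ_N(θ₁) A₁ᵀ U(θ₁-θ₂) A₁ Θ_N(θ₂)ᵀ dθ₂ dθ₁`. -/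
def J3 {n : ℕ} (N : ℕ) (h : ℝ) (A₁ : Matrix (Fin n) (Fin n) ℝ)
    (U : ℝ → Matrix (Fin n) (Fin n) ℝ) : Matrix (Fin N × Fin n) (Fin N × Fin n) ℝ :=
  Matrix.of fun q r => ∫ θ₁ in (-h)..0, ∫ θ₂ in (-h)..0,
    (theta n N θ₁ * (A₁ᵀ * U (θ₁ - θ₂) * A₁) * thetaT n N θ₂) q r

/-- `J₄ = ∫∫ Θ_N(θ₁) A₁ᵀ U'(θ₁-θ₂) D Θ_N(θ₂)ᵀ dθ₂ dθ₁`. -/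
def J4 {n : ℕ} (N : ℕ) (h : ℝ) (A₁ D : Matrix (Fin n) (Fin n) ℝ)
    (U : ℝ → Matrix (Fin n) (Fin n) ℝ) : Matrix (Fin N × Fin n) (Fin N × Fin n) ℝ :=
  Matrix.of fun q r => ∫ θ₁ in (-h)..0, ∫ θ₂ in (-h)..0,
    (theta n N θ₁ * (A₁ᵀ * mderiv U (θ₁ - θ₂) * D) * thetaT n N θ₂) q r

/-- `J₅ = ∫ (∫_{θ₂<θ₁} + ∫_{θ₂>θ₁}) Θ_N(θ₁) Dᵀ U''(θ₁-θ₂) D Θ_N(θ₂)ᵀ dθ₂ dθ₁`. -/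
def J5 {n : ℕ} (N : ℕ) (h : ℝ) (D : Matrix (Fin n) (Fin n) ℝ)
    (U : ℝ → Matrix (Fin n) (Fin n) ℝ) : Matrix (Fin N × Fin n) (Fin N × Fin n) ℝ :=
  Matrix.of fun q r => ∫ θ₁ in (-h)..0,
    ((∫ θ₂ in (-h)..θ₁,
        (theta n N θ₁ * (Dᵀ * mderiv (mderiv U) (θ₁ - θ₂) * D) * thetaT n N θ₂) q r)
      + ∫ θ₂ in θ₁..0,
        (theta n N θ₁ * (Dᵀ * mderiv (mderiv U) (θ₁ - θ₂) * D) * thetaT n N θ₂) q r)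

/-- `J₆ = ∫ Θ_N(θ) Dᵀ P D Θ_N(θ)ᵀ dθ`. -/
def J6 {n : ℕ} (N : ℕ) (h : ℝ) (D P : Matrix (Fin n) (Fin n) ℝ) :
    Matrix (Fin N × Fin n) (Fin N × Fin n) ℝ :=
  Matrix.of fun q r => ∫ θ in (-h)..0, (theta n N θ * (Dᵀ * P * D) * thetaT n N θ) q r

/-- The symmetric matrix `𝐏_N` of the quadratic form obtained from the functional. The matrix `J₄`
is not symmetric in general, so its contribution to the symmetric matrix is `J₄ + J₄ᵀ`. -/
def PMat {n : ℕ} (N : ℕ) (h : ℝ) (A₁ D : Matrix (Fin n) (Fin n) ℝ)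
    (U : ℝ → Matrix (Fin n) (Fin n) ℝ) (P : Matrix (Fin n) (Fin n) ℝ) :
    Matrix (Fin n ⊕ Fin N × Fin n) (Fin n ⊕ Fin N × Fin n) ℝ :=
  Matrix.fromBlocks (U 0) (J1 N h A₁ U - J2 N h D U) (J1 N h A₁ U - J2 N h D U)ᵀ
    (J3 N h A₁ U + (J4 N h A₁ D U + (J4 N h A₁ D U)ᵀ) - J5 N h D U - J6 N h D P)

end

end NeutralDelay

namespace NeutralDelay

noncomputable section

/-! The functional `v(ξ, φ)` is nonnegative for every vector `ξ` and every `C¹` function `φ`, with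
`ξ` independent of `φ`, and `𝐏_N` is the matrix of `v` restricted to `φ = Θ_Nᵀ Φ`.

Regularity comes first, since the hypotheses give only a continuous `U`, differentiable on the open
half-intervals, while `v` contains `U''`. Stability of the system forces `Dᵏ v → 0`
(`ExpStable.tendsto_pow`). With initial data `sin(ωs) v` the primitive of the solution is again a
solution, of size `O(1/ω)`. Hence `w(t) - D w(t - h)` is `O(1/ω)`, and `w` at distance `k h` is
close to `Dᵏ` applied to its initial value, while `w` itself decays. So the Stein map `X ↦ X - Dᵀ X
D` is injective, and the dynamic and symmetry equations can be solved for `U'(θ)` linearly in `U(θ)`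
and `U(h - θ)`. Bootstrapping gives a `C²` function `V` on the line that equals `U` on `[0, h]`
(`IsDelayLyapunovMatrix.exists_smooth`).

With `V` in place of `U`, the functional has continuous kernels on either side of the diagonal.
Along a solution its derivative is `-xᵀ W x` (`IsSmoothLyapunov.hasDerivAt_functional`), and it
tends to `0` because the solution does. Thus `v₀(φ) ≥ 0` for `C¹` data. For arbitrary `ξ`, the
function `φ` is corrected near `0` by a bounded term which vanishes in the limit inside the interval
(`IsSmoothLyapunov.nonneg`).

The quadratic form of `𝐏_N` at `(ξ, Φ)` is `v(ξ, Θ_Nᵀ Φ)` by linearity of the integrals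
(`PMat_eq_expanded`), so positivity follows. The polynomial statements are the same identity after
expansion in monomials. -/

/-! ### Differentiation of parametric and triangular integrals -/

/-- Leibniz rule for a fixed lower limit. -/
theorem hasDerivAt_integral_fixed {f f' : ℝ → ℝ → ℝ}
    (hf : Continuous (Function.uncurry f)) (hf' : Continuous (Function.uncurry f'))
    (hd : ∀ t s, HasDerivAt (fun t => f t s) (f' t s) t) (p t : ℝ) :
    HasDerivAt (fun t => ∫ s in (0 : ℝ)..p, f t s) (∫ s in (0 : ℝ)..p, f' t s) t := by
  have hK : IsCompact (Icc (t - 1) (t + 1) ×ˢ uIcc 0 p) := isCompact_Icc.prod isCompact_uIcc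
  obtain ⟨C, hC⟩ := hK.exists_bound_of_continuousOn hf'.continuousOn
  have hcf : ∀ t, Continuous (f t) := fun t => hf.comp (Continuous.prodMk_right t)
  have hcf' : ∀ t, Continuous (f' t) := fun t => hf'.comp (Continuous.prodMk_right t)
  refine (intervalIntegral.hasDerivAt_integral_of_dominated_loc_of_deriv_le
    (F := f) (F' := f') (s := Icc (t - 1) (t + 1)) (bound := fun _ => C)
    (Icc_mem_nhds (by linarith) (by linarith))
    (Eventually.of_forall fun x => (hcf x).aestronglyMeasurable)
    ((hcf t).intervalIntegrable _ _) (hcf' t).aestronglyMeasurable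
    (Eventually.of_forall fun s hs x hx => hC (x, s) ⟨hx, uIoc_subset_uIcc hs⟩)
    intervalIntegrable_const (Eventually.of_forall fun s _ x _ => hd x s)).2

/-- Leibniz rule with both limits varying. -/
theorem hasDerivAt_integral_param {f f' : ℝ → ℝ → ℝ}
    (hf : Continuous (Function.uncurry f)) (hf' : Continuous (Function.uncurry f'))
    (hd : ∀ t s, HasDerivAt (fun t => f t s) (f' t s) t) {a b : ℝ → ℝ} {a' b' t : ℝ}
    (ha : HasDerivAt a a' t) (hb : HasDerivAt b b' t) :
    HasDerivAt (fun t => ∫ s in a t..b t, f t s)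
      (b' * f t (b t) - a' * f t (a t) + ∫ s in a t..b t, f' t s) t := by
  have hcf : ∀ t, Continuous (f t) := fun t => hf.comp (Continuous.prodMk_right t)
  have hcf' : ∀ t, Continuous (f' t) := fun t => hf'.comp (Continuous.prodMk_right t)
  have key : ∀ {c : ℝ → ℝ} {c' : ℝ}, HasDerivAt c c' t →
      HasDerivAt (fun t => ∫ s in (0 : ℝ)..c t, f t s)
        (c' * f t (c t) + ∫ s in (0 : ℝ)..c t, f' t s) t := by
    intro c c' hc
    -- The integral is regarded as a function of two variables, parameter and endpoint. Continuous
    -- partial derivatives make it jointly differentiable, and the chain rule along `t ↦ (t, c t)`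
    -- applies.
    have hS := hasStrictFDerivAt_uncurry_coprod (𝕜 := ℝ) (u := (t, c t))
      (f := fun q p => ∫ s in (0 : ℝ)..p, f q s)
      (f₁ := fun q p => ContinuousLinearMap.toSpanSingleton ℝ (∫ s in (0 : ℝ)..p, f' q s))
      (f₂ := fun q p => ContinuousLinearMap.toSpanSingleton ℝ (f q p))
      (Eventually.of_forall fun v =>
        (hasDerivAt_integral_fixed hf hf' hd v.2 v.1).hasFDerivAt)
      (Eventually.of_forall fun v =>
        (intervalIntegral.integral_hasDerivAt_right ((hcf v.1).intervalIntegrable _ _)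
          ((hcf v.1).stronglyMeasurableAtFilter _ _) (hcf v.1).continuousAt).hasFDerivAt)
      (by
        have : Continuous fun v : ℝ × ℝ => ∫ s in (0 : ℝ)..v.2, f' v.1 s :=
          intervalIntegral.continuous_parametric_primitive_of_continuous hf'
        exact ((ContinuousLinearMap.toSpanSingletonCLE (𝕜 := ℝ) (E := ℝ)).continuous.comp
          this).continuousAt)
      ((ContinuousLinearMap.toSpanSingletonCLE (𝕜 := ℝ) (E := ℝ)).continuous.comp
          hf).continuousAt
    have := hS.hasFDerivAt.comp_hasDerivAt t ((hasDerivAt_id t).prodMk hc)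
    refine this.congr_deriv ?_
    simp [Function.HasUncurry.uncurry]
    ring
  have hsub := (key hb).sub (key ha)
  have e : ∀ t, (∫ s in (0 : ℝ)..b t, f t s) - (∫ s in (0 : ℝ)..a t, f t s)
      = ∫ s in a t..b t, f t s := fun t =>
    intervalIntegral.integral_interval_sub_left ((hcf t).intervalIntegrable _ _)
      ((hcf t).intervalIntegrable _ _)
  have e' : (∫ s in (0 : ℝ)..b t, f' t s) - (∫ s in (0 : ℝ)..a t, f' t s)
      = ∫ s in a t..b t, f' t s :=
    intervalIntegral.integral_interval_sub_left ((hcf' t).intervalIntegrable _ _)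
      ((hcf' t).intervalIntegrable _ _)
  refine (hsub.congr_of_eventuallyEq (Eventually.of_forall fun t => (e t).symm)).congr_deriv ?_
  rw [← e']
  ring

/-- A double integral over the square `[a, c]²` whose kernel is `k₁` below and `k₂` above the
diagonal. -/
def triInt (a c : ℝ) (k₁ k₂ : ℝ → ℝ → ℝ) : ℝ :=
  ∫ s in a..c, ((∫ r in a..s, k₁ s r) + ∫ r in s..c, k₂ s r)

theorem continuous_integral_lower {k : ℝ → ℝ → ℝ} (hk : Continuous (Function.uncurry k))
    {u v : ℝ × ℝ → ℝ} (hu : Continuous u) (hv : Continuous v) {w : ℝ × ℝ → ℝ}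
    (hw : Continuous w) :
    Continuous fun p : ℝ × ℝ => ∫ r in u p..v p, k (w p) r := by
  have hc : ∀ t, Continuous (k t) := fun t => hk.comp (Continuous.prodMk_right t)
  have h0 : ∀ {v : ℝ × ℝ → ℝ}, Continuous v →
      Continuous fun p : ℝ × ℝ => ∫ r in (0 : ℝ)..v p, k (w p) r := fun {v} hv =>
    intervalIntegral.continuous_parametric_intervalIntegral_of_continuous
      (f := fun p r => k (w p) r)
      (by
        have : Continuous fun q : (ℝ × ℝ) × ℝ => (w q.1, q.2) := by fun_prop
        exact hk.comp this) hv
  refine ((h0 hv).sub (h0 hu)).congr fun p => ?_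
  exact intervalIntegral.integral_interval_sub_left ((hc _).intervalIntegrable _ _)
      ((hc _).intervalIntegrable _ _)

theorem continuous_integral_interval {k : ℝ → ℝ → ℝ} (hk : Continuous (Function.uncurry k))
    {u v : ℝ → ℝ} (hu : Continuous u) (hv : Continuous v) :
    Continuous fun s : ℝ => ∫ r in u s..v s, k s r := by
  have := continuous_integral_lower hk (u := fun p => u p.1) (v := fun p => v p.1)
    (w := fun p => p.1) (by fun_prop) (by fun_prop) (by fun_prop)
  exact this.comp (Continuous.prodMk_left (0 : ℝ))

/-- When the square moves along the diagonal, only its four edges contribute. The kernels are not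
differentiated in the motion, so continuity suffices. -/
theorem hasDerivAt_triInt {k₁ k₂ : ℝ → ℝ → ℝ} (h₁ : Continuous (Function.uncurry k₁))
    (h₂ : Continuous (Function.uncurry k₂)) (h t : ℝ) :
    HasDerivAt (fun t => triInt (t - h) t k₁ k₂)
      ((∫ r in (t - h)..t, k₁ t r) - (∫ r in (t - h)..t, k₂ (t - h) r)
        + ∫ s in (t - h)..t, (k₂ s t - k₁ s (t - h))) t := by
  have hc₁ : ∀ t, Continuous (k₁ t) := fun t => h₁.comp (Continuous.prodMk_right t)
  have hc₂ : ∀ t, Continuous (k₂ t) := fun t => h₂.comp (Continuous.prodMk_right t)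
  have hsub : ∀ t : ℝ, HasDerivAt (fun t => t - h) 1 t := fun t => (hasDerivAt_id t).sub_const h
  have := hasDerivAt_integral_param
    (f := fun t s => (∫ r in (t - h)..s, k₁ s r) + ∫ r in s..t, k₂ s r)
    (f' := fun t s => k₂ s t - k₁ s (t - h)) (t := t)
    (by
      refine (continuous_integral_lower h₁ (u := fun p => p.1 - h) (v := fun p => p.2)
        (w := fun p => p.2) (by fun_prop) (by fun_prop) (by fun_prop)).add
        (continuous_integral_lower h₂ (u := fun p => p.2) (v := fun p => p.1)
        (w := fun p => p.2) (by fun_prop) (by fun_prop) (by fun_prop)))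
    (by
      have e1 : Continuous fun p : ℝ × ℝ => (p.2, p.1) := by fun_prop
      have e2 : Continuous fun p : ℝ × ℝ => (p.2, p.1 - h) := by fun_prop
      exact (h₂.comp e1).sub (h₁.comp e2))
    (fun t s => by
      have d1 : HasDerivAt (fun u => ∫ r in u..s, k₁ s r) (-k₁ s (t - h)) (t - h) :=
        intervalIntegral.integral_hasDerivAt_left ((hc₁ s).intervalIntegrable _ _)
          ((hc₁ s).stronglyMeasurableAtFilter _ _) (hc₁ s).continuousAt
      have d1' : HasDerivAt (fun t => ∫ r in (t - h)..s, k₁ s r) (-k₁ s (t - h) * 1) t :=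
        d1.comp (h₂ := fun u => ∫ r in u..s, k₁ s r) (h := fun t => t - h) t (hsub t)
      have d2 : HasDerivAt (fun u => ∫ r in s..u, k₂ s r) (k₂ s t) t :=
        intervalIntegral.integral_hasDerivAt_right ((hc₂ s).intervalIntegrable _ _)
          ((hc₂ s).stronglyMeasurableAtFilter _ _) (hc₂ s).continuousAt
      exact (d1'.add d2).congr_deriv (by ring))
    (hsub t) (hasDerivAt_id t)
  refine this.congr_deriv ?_
  simp

/-- Fubini on a triangle: as functions of the endpoint `c`, both sides have derivative `∫ r in a..c,
k c r`, and both vanish at `c = a`. -/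
theorem integral_triangle_swap {k : ℝ → ℝ → ℝ} (hk : Continuous (Function.uncurry k)) (a c : ℝ) :
    ∫ s in a..c, ∫ r in a..s, k s r = ∫ s in a..c, ∫ r in s..c, k r s := by
  have hc : ∀ t, Continuous (k t) := fun t => hk.comp (Continuous.prodMk_right t)
  have hk' : Continuous (Function.uncurry fun s r => k r s) := hk.comp continuous_swap
  have hc' : ∀ t, Continuous fun r => k r t := fun t => hk.comp (Continuous.prodMk_left t)
  have hF : Continuous fun s => ∫ r in a..s, k s r :=
    continuous_integral_interval hk continuous_const continuous_id
  have dl : ∀ c, HasDerivAt (fun c => ∫ s in a..c, ∫ r in a..s, k s r) (∫ r in a..c, k c r) c :=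
    fun c => intervalIntegral.integral_hasDerivAt_right (hF.intervalIntegrable _ _)
      (hF.stronglyMeasurableAtFilter _ _) hF.continuousAt
  have dr : ∀ c, HasDerivAt (fun c => ∫ s in a..c, ∫ r in s..c, k r s) (∫ r in a..c, k c r) c := by
    intro c
    have := hasDerivAt_integral_param (f := fun c s => ∫ r in s..c, k r s)
      (f' := fun c s => k c s) (t := c)
      (continuous_integral_lower hk' (u := fun p => p.2) (v := fun p => p.1)
        (w := fun p => p.2) (by fun_prop) (by fun_prop) (by fun_prop)) hk
      (fun t s => intervalIntegral.integral_hasDerivAt_right ((hc' s).intervalIntegrable _ _)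
          ((hc' s).stronglyMeasurableAtFilter _ _) (hc' s).continuousAt)
      (hasDerivAt_const c a) (hasDerivAt_id c)
    refine this.congr_deriv ?_
    simp
  have hconst := is_const_of_deriv_eq_zero (f := fun c =>
      (∫ s in a..c, ∫ r in a..s, k s r) - ∫ s in a..c, ∫ r in s..c, k r s)
    (fun c => ((dl c).sub (dr c)).differentiableAt)
    (fun c => (((dl c).sub (dr c)).congr_deriv (sub_self _)).deriv) c a
  simpa [sub_eq_zero] using hconst

theorem triInt_swap {k₁ k₂ : ℝ → ℝ → ℝ} (h₁ : Continuous (Function.uncurry k₁))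
    (h₂ : Continuous (Function.uncurry k₂)) (a c : ℝ) :
    triInt a c k₁ k₂ = triInt a c (fun s r => k₂ r s) (fun s r => k₁ r s) := by
  have h₁' : Continuous (Function.uncurry fun s r => k₁ r s) := h₁.comp continuous_swap
  have h₂' : Continuous (Function.uncurry fun s r => k₂ r s) := h₂.comp continuous_swap
  have c1 : ∀ {k : ℝ → ℝ → ℝ}, Continuous (Function.uncurry k) →
      IntervalIntegrable (fun s => ∫ r in a..s, k s r) volume a c := fun hk =>
    (continuous_integral_interval hk continuous_const continuous_id).intervalIntegrable _ _
  have c2 : ∀ {k : ℝ → ℝ → ℝ}, Continuous (Function.uncurry k) →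
      IntervalIntegrable (fun s => ∫ r in s..c, k s r) volume a c := fun hk =>
    (continuous_integral_interval hk continuous_id continuous_const).intervalIntegrable _ _
  unfold triInt
  rw [intervalIntegral.integral_add (c1 h₁) (c2 h₂),
    intervalIntegral.integral_add (c1 h₂') (c2 h₁'), integral_triangle_swap h₁,
    integral_triangle_swap h₂', add_comm]

/-! ### Variation of constants -/

section LinearODE

variable {E : Type*} [NormedAddCommGroup E] [NormedSpace ℝ E]

/-- The solution of `y' = a y + F`, `y 0 = y₀`, by variation of constants. -/
def linSol (a : E →L[ℝ] E) (y₀ : E) (F : ℝ → E) (t : ℝ) : E :=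
  NormedSpace.exp (t • a) (y₀ + ∫ s in (0 : ℝ)..t, NormedSpace.exp (-(s • a)) (F s))

theorem linSol_zero (a : E →L[ℝ] E) (y₀ : E) (F : ℝ → E) : linSol a y₀ F 0 = y₀ := by
  simp [linSol]

theorem hasDerivAt_linSol [CompleteSpace E] (a : E →L[ℝ] E) (y₀ : E) {F : ℝ → E}
    (hF : Continuous F) (t : ℝ) :
    HasDerivAt (linSol a y₀ F) (a (linSol a y₀ F t) + F t) t := by
  have he : ∀ t : ℝ, HasDerivAt (fun u : ℝ => NormedSpace.exp (u • a))
      (a * NormedSpace.exp (t • a)) t := fun t => hasDerivAt_exp_smul_const' a t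
  have hc : Continuous fun u : ℝ => NormedSpace.exp (u • a) :=
    continuous_iff_continuousAt.2 fun t => (he t).continuousAt
  have hc' : Continuous fun u : ℝ => NormedSpace.exp (-(u • a)) := by
    have := hc.comp continuous_neg
    simpa [Function.comp_def] using this
  have hG : Continuous fun s : ℝ => NormedSpace.exp (-(s • a)) (F s) := hc'.clm_apply hF
  have hI : HasDerivAt (fun t => y₀ + ∫ s in (0 : ℝ)..t, NormedSpace.exp (-(s • a)) (F s))
      (NormedSpace.exp (-(t • a)) (F t)) t :=
    (intervalIntegral.integral_hasDerivAt_right (hG.intervalIntegrable _ _)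
      (hG.stronglyMeasurableAtFilter _ _) hG.continuousAt).const_add _
  have h := (he t).clm_apply hI
  have hinv : NormedSpace.exp (t • a) * NormedSpace.exp (-(t • a)) = 1 := by
    let : NormedAlgebra ℚ (E →L[ℝ] E) := NormedAlgebra.restrictScalars ℚ ℝ _
    rw [← NormedSpace.exp_add_of_commute (Commute.neg_right (Commute.refl _)), add_neg_cancel,
      NormedSpace.exp_zero]
  refine h.congr_deriv ?_
  rw [← mul_apply_eq_comp, hinv]
  simp [linSol]

theorem linSol_congr (a : E →L[ℝ] E) (y₀ : E) {F G : ℝ → E} {t : ℝ}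
    (h : ∀ s ∈ uIcc 0 t, F s = G s) : linSol a y₀ F t = linSol a y₀ G t := by
  unfold linSol
  rw [intervalIntegral.integral_congr (g := fun s => NormedSpace.exp (-(s • a)) (G s))]
  intro s hs
  simp [h s hs]

end LinearODE

/-! ### Solutions by the method of steps -/

section Existence

variable {n : ℕ}

/-- Multiplication by a matrix as a continuous linear map. -/
def mulVecCLM (A : Matrix (Fin n) (Fin n) ℝ) : (Fin n → ℝ) →L[ℝ] (Fin n → ℝ) :=
  LinearMap.toContinuousLinearMap A.mulVecLin

@[simp] theorem mulVecCLM_apply (A : Matrix (Fin n) (Fin n) ℝ) (v : Fin n → ℝ) :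
    mulVecCLM A v = A *ᵥ v := rfl

theorem continuous_mulVec_comp (A : Matrix (Fin n) (Fin n) ℝ) {x : ℝ → Fin n → ℝ}
    (hx : Continuous x) : Continuous fun t => A *ᵥ x t :=
  (mulVecCLM A).continuous.comp hx

/-- The function `y(t) = x(t) - D x(t - h)` determined by the past values of `x`. -/
def stepY (h : ℝ) (A₀ A₁ D : Matrix (Fin n) (Fin n) ℝ) (φ x : ℝ → Fin n → ℝ) : ℝ → Fin n → ℝ :=
  linSol (mulVecCLM A₀) (φ 0 - D *ᵥ φ (-h)) fun s => (A₀ * D + A₁) *ᵥ x (s - h)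

/-- One step of the method of steps. -/
def stepX (h : ℝ) (A₀ A₁ D : Matrix (Fin n) (Fin n) ℝ) (φ x : ℝ → Fin n → ℝ) (t : ℝ) :
    Fin n → ℝ :=
  if t ≤ 0 then φ t else stepY h A₀ A₁ D φ x t + D *ᵥ x (t - h)

theorem hasDerivAt_stepY {h : ℝ} {A₀ A₁ D : Matrix (Fin n) (Fin n) ℝ} {φ x : ℝ → Fin n → ℝ}
    (hx : Continuous x) (t : ℝ) :
    HasDerivAt (stepY h A₀ A₁ D φ x)
      (A₀ *ᵥ stepY h A₀ A₁ D φ x t + (A₀ * D + A₁) *ᵥ x (t - h)) t :=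
  hasDerivAt_linSol _ _ (continuous_mulVec_comp _ (hx.comp (continuous_id.sub continuous_const))) t

theorem continuous_stepX {h : ℝ} {A₀ A₁ D : Matrix (Fin n) (Fin n) ℝ} {φ x : ℝ → Fin n → ℝ}
    (hφ : Continuous φ) (hx : Continuous x) (hxh : x (-h) = φ (-h)) :
    Continuous (stepX h A₀ A₁ D φ x) := by
  have hy : Continuous (stepY h A₀ A₁ D φ x) :=
    continuous_iff_continuousAt.2 fun t => (hasDerivAt_stepY hx t).continuousAt
  refine Continuous.if_le hφ (hy.add (continuous_mulVec_comp D
    (hx.comp (continuous_id.sub continuous_const)))) continuous_id continuous_const ?_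
  rintro t rfl
  simp [stepY, linSol_zero, hxh]

theorem stepY_congr {h : ℝ} {A₀ A₁ D : Matrix (Fin n) (Fin n) ℝ} {φ x x' : ℝ → Fin n → ℝ} {t : ℝ}
    (ht : 0 ≤ t) (hxx : ∀ s ≤ t - h, x s = x' s) :
    stepY h A₀ A₁ D φ x t = stepY h A₀ A₁ D φ x' t := by
  refine linSol_congr _ _ fun s hs => ?_
  rw [uIcc_of_le ht] at hs
  rw [hxx (s - h) (by linarith [hs.2])]

/-- The step is causal with lag `h`: correct values up to `t - h` give correct values up to `t`.
This makes the iteration stabilise. -/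
theorem stepX_congr {h : ℝ} {A₀ A₁ D : Matrix (Fin n) (Fin n) ℝ} {φ x x' : ℝ → Fin n → ℝ} {t : ℝ}
    (hxx : ∀ s ≤ t - h, x s = x' s) :
    stepX h A₀ A₁ D φ x t = stepX h A₀ A₁ D φ x' t := by
  unfold stepX
  split_ifs with ht
  · rfl
  · rw [stepY_congr (not_le.1 ht).le hxx, hxx (t - h) le_rfl]

/-- Continuous initial functions have continuous solutions; moreover `y(t) = x(t) - D x(t - h)`
extends to a solution of its differential equation on the whole line. -/
theorem exists_continuous_solution {h : ℝ} (hh : 0 < h) (A₀ A₁ D : Matrix (Fin n) (Fin n) ℝ)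
    {φ : ℝ → Fin n → ℝ} (hφ : Continuous φ) :
    ∃ x y : ℝ → Fin n → ℝ, Continuous x ∧ (∀ t ≤ 0, x t = φ t) ∧
      (∀ t, HasDerivAt y (A₀ *ᵥ (y t + D *ᵥ x (t - h)) + A₁ *ᵥ x (t - h)) t) ∧
      ∀ t, 0 ≤ t → x t = y t + D *ᵥ x (t - h) := by
  set S := stepX h A₀ A₁ D φ with hS
  set X : ℕ → ℝ → Fin n → ℝ := fun k => S^[k] φ with hX
  have hsucc : ∀ k, X (k + 1) = S (X k) := fun k => Function.iterate_succ_apply' S k φ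
  have hneg : ∀ k, ∀ t ≤ 0, X k t = φ t := by
    intro k t ht
    cases k with
    | zero => rfl
    | succ k => rw [hsucc, hS]; simp [stepX, ht]
  have hcont : ∀ k, Continuous (X k) := by
    intro k
    induction k with
    | zero => exact hφ
    | succ k ih => rw [hsucc]; exact continuous_stepX hφ ih (hneg k _ (by linarith))
  have hstep : ∀ k : ℕ, ∀ t ≤ k * h, X (k + 1) t = X k t := by
    intro k
    induction k with
    | zero =>
      intro t ht
      have : t ≤ 0 := by simpa using ht
      rw [hneg _ _ this, hneg _ _ this]
    | succ k ih =>
      intro t ht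
      rw [hsucc (k + 1)]
      conv_rhs => rw [hsucc k]
      refine stepX_congr fun s hs => ih s ?_
      push_cast at ht
      linarith
  have hstab : ∀ k m : ℕ, ∀ t ≤ k * h, X (k + m) t = X k t := by
    intro k m t ht
    induction m with
    | zero => rfl
    | succ m ih =>
      rw [← add_assoc, hstep (k + m) t ?_, ih]
      push_cast
      nlinarith [Nat.cast_nonneg (α := ℝ) m]
  -- The `k`-th iterate is final on `t ≤ k h`, so each `t` is read off from the first iterate that
  -- is final there.
  set x : ℝ → Fin n → ℝ := fun t => X ⌈t / h⌉₊ t with hx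
  have hxk : ∀ k : ℕ, ∀ t ≤ k * h, x t = X k t := by
    intro k t ht
    have hle : ⌈t / h⌉₊ ≤ k := Nat.ceil_le.2 ((div_le_iff₀ hh).2 ht)
    obtain ⟨m, rfl⟩ := Nat.exists_eq_add_of_le hle
    exact (hstab _ m t ((div_le_iff₀ hh).1 (Nat.le_ceil _))).symm
  have hlarge : ∀ t, ∃ k : ℕ, t < k * h := fun t => by
    obtain ⟨k, hk⟩ := exists_nat_gt (t / h)
    exact ⟨k, (div_lt_iff₀ hh).1 hk⟩
  have hxc : Continuous x := by
    rw [continuous_iff_continuousAt]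
    intro t
    obtain ⟨k, hk⟩ := hlarge t
    refine (hcont k).continuousAt.congr ?_
    filter_upwards [Iio_mem_nhds hk] with s hs using (hxk k s (le_of_lt hs)).symm
  have hx0 : ∀ t ≤ 0, x t = φ t := fun t ht => by
    rw [hxk 0 t (by simpa using ht), hneg 0 t ht]
  refine ⟨x, stepY h A₀ A₁ D φ x, hxc, hx0, fun t => ?_, fun t ht => ?_⟩
  · refine (hasDerivAt_stepY hxc t).congr_deriv ?_
    simp [mulVec_add, add_mulVec, add_assoc]
  · rcases ht.eq_or_lt with rfl | ht
    · simp [stepY, linSol_zero, hx0 0 le_rfl, hx0 (-h) (by linarith)]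
    · obtain ⟨k, hk⟩ := hlarge t
      have hk' : t ≤ (k + 1 : ℕ) * h := by push_cast; linarith
      rw [hxk (k + 1) t hk', hsucc, hS]
      have hxx : ∀ s ≤ t - h, X k s = x s := fun s hs => (hxk k s (by linarith)).symm
      rw [stepX_congr hxx, stepX, if_neg (not_le.2 ht)]

end Existence

/-! ### Stability of the difference operator -/

section Stability

variable {n : ℕ}

theorem norm_le_eucl (v : Fin n → ℝ) : ‖v‖ ≤ eucl v :=
  (pi_norm_le_iff_of_nonneg (norm_nonneg _)).2 fun i => PiLp.norm_apply_le (WithLp.toLp 2 v) i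

theorem exists_eucl_le (n : ℕ) : ∃ c : ℝ, 0 ≤ c ∧ ∀ v : Fin n → ℝ, eucl v ≤ c * ‖v‖ :=
  ⟨_, norm_nonneg _, fun v =>
    ((PiLp.continuousLinearEquiv 2 ℝ fun _ : Fin n => ℝ).symm.toContinuousLinearMap).le_opNorm v⟩

theorem isPC1On_of_contDiff {φ : ℝ → Fin n → ℝ} (hφ : ContDiff ℝ 1 φ) (a b : ℝ) :
    IsPC1On φ a b := by
  have hd : Continuous (deriv φ) := hφ.continuous_deriv le_rfl
  exact ⟨⟨∅, fun t _ _ => hφ.contDiffAt⟩,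
    fun t _ => ⟨⟨_, (hφ.continuous.tendsto t).mono_left nhdsWithin_le_nhds⟩,
      ⟨_, (hd.tendsto t).mono_left nhdsWithin_le_nhds⟩⟩,
    fun t _ => ⟨⟨_, (hφ.continuous.tendsto t).mono_left nhdsWithin_le_nhds⟩,
      ⟨_, (hd.tendsto t).mono_left nhdsWithin_le_nhds⟩⟩⟩

theorem isSolution_of_continuous {h : ℝ} {A₀ A₁ D : Matrix (Fin n) (Fin n) ℝ}
    {φ x : ℝ → Fin n → ℝ} (hx : Continuous x) (hφ : ∀ t ≤ 0, x t = φ t)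
    (he : ∀ t, 0 < t →
      HasDerivAt (fun s => x s - D *ᵥ x (s - h)) (A₀ *ᵥ x t + A₁ *ᵥ x (t - h)) t) :
    IsSolution h A₀ A₁ D φ x where
  initial θ hθ := hφ θ hθ.2
  piecewise _ _ := ⟨⟨∅, fun _ _ _ => hx.continuousAt⟩,
    fun t _ => ⟨_, (hx.tendsto t).mono_left nhdsWithin_le_nhds⟩,
    fun t _ => ⟨_, (hx.tendsto t).mono_left nhdsWithin_le_nhds⟩⟩
  continuous_diff := (hx.sub (continuous_mulVec_comp D
    (hx.comp (continuous_id.sub continuous_const)))).continuousOn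
  equation := ⟨∅, countable_empty, fun t ht _ => he t ht⟩

theorem isSolution_of_pair {h : ℝ} {A₀ A₁ D : Matrix (Fin n) (Fin n) ℝ}
    {φ x y : ℝ → Fin n → ℝ} (hx : Continuous x) (hφ : ∀ t ≤ 0, x t = φ t)
    (hy : ∀ t, HasDerivAt y (A₀ *ᵥ (y t + D *ᵥ x (t - h)) + A₁ *ᵥ x (t - h)) t)
    (hxy : ∀ t, 0 ≤ t → x t = y t + D *ᵥ x (t - h)) : IsSolution h A₀ A₁ D φ x := by
  refine isSolution_of_continuous hx hφ fun t ht => ?_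
  rw [hxy t ht.le]
  refine (hy t).congr_of_eventuallyEq ?_
  filter_upwards [Ioi_mem_nhds ht] with s hs
  rw [hxy s (le_of_lt hs), add_sub_cancel_right]

/-- Exponential stability in the maximum norm, for continuously differentiable initial data. -/
theorem ExpStable.exists_norm_bound {h : ℝ} (hh : 0 < h) {A₀ A₁ D : Matrix (Fin n) (Fin n) ℝ}
    (hs : ExpStable h A₀ A₁ D) :
    ∃ γ : ℝ, 0 ≤ γ ∧ ∃ σ > 0, ∀ φ : ℝ → Fin n → ℝ, ContDiff ℝ 1 φ →
      ∀ x : ℝ → Fin n → ℝ, IsSolution h A₀ A₁ D φ x → ∀ B : ℝ,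
        (∀ θ ∈ Icc (-h) 0, ‖φ θ‖ ≤ B) → ∀ t : ℝ, 0 ≤ t →
          ‖x t‖ ≤ γ * Real.exp (-σ * t) * B := by
  obtain ⟨γ, hγ, σ, hσ, H⟩ := hs
  obtain ⟨c, hc, hcv⟩ := exists_eucl_le n
  refine ⟨γ * c, by positivity, σ, hσ, fun φ hφ x hx B hB t ht => ?_⟩
  have h1 : supNorm h φ ≤ c * B := by
    refine csSup_le ((nonempty_Icc.2 (by linarith)).image _) ?_
    rintro _ ⟨θ, hθ, rfl⟩
    exact (hcv _).trans (mul_le_mul_of_nonneg_left (hB θ hθ) hc)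
  calc ‖x t‖ ≤ eucl (x t) := norm_le_eucl _
    _ ≤ γ * Real.exp (-σ * t) * supNorm h φ := H φ (isPC1On_of_contDiff hφ _ _) x hx t ht
    _ ≤ γ * Real.exp (-σ * t) * (c * B) := by gcongr
    _ = γ * c * Real.exp (-σ * t) * B := by ring

/-- Unrolling the recursion `k` times. The point is that `C` depends only on `d` and `k`, so `δ` can
be sent to `0` over a family of solutions with `k` fixed. -/
theorem exists_difference_iterate_bound {E : Type*} [NormedAddCommGroup E] [NormedSpace ℝ E]
    {h : ℝ} (hh : 0 < h) (d : E →L[ℝ] E) (k : ℕ) :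
    ∃ C : ℝ, ∀ (w y : ℝ → E) (δ : ℝ), (∀ t, 0 ≤ t → w t = y t + d (w (t - h))) →
      (∀ t, 0 ≤ t → ‖y t‖ ≤ δ) → ∀ s, -h ≤ s → ‖w (s + k * h) - (d ^ k) (w s)‖ ≤ C * δ := by
  induction k with
  | zero => exact ⟨0, fun w y δ _ _ s _ => by simp⟩
  | succ k ih =>
    obtain ⟨C, hC⟩ := ih
    refine ⟨1 + ‖d‖ * C, fun w y δ hw hy s hs => ?_⟩
    have h0 : 0 ≤ s + (k + 1 : ℕ) * h := by
      push_cast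
      nlinarith [Nat.cast_nonneg (α := ℝ) k]
    have e1 : s + (k + 1 : ℕ) * h - h = s + k * h := by push_cast; ring
    rw [hw _ h0, e1, pow_succ', mul_apply_eq_comp, add_sub_assoc, ← map_sub]
    calc _ ≤ ‖y (s + (k + 1 : ℕ) * h)‖ + ‖d (w (s + k * h) - (d ^ k) (w s))‖ := norm_add_le _ _
      _ ≤ δ + ‖d‖ * (C * δ) := by
        gcongr
        · exact hy _ h0
        · exact (d.le_opNorm _).trans (mul_le_mul_of_nonneg_left (hC w y δ hw hy s hs)
            (norm_nonneg _))
      _ = _ := by ring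

/-- The primitive of a solution with oscillating initial function is again a solution. -/
theorem exists_oscillating_solution {h : ℝ} (hh : 0 < h) (A₀ A₁ D : Matrix (Fin n) (Fin n) ℝ)
    {ω : ℝ} (hω : 0 < ω) (hωh : Real.sin (ω * h) = 0) (hωh' : Real.cos (ω * h) = 1)
    (v : Fin n → ℝ) :
    ∃ w y X : ℝ → Fin n → ℝ,
      IsSolution h A₀ A₁ D (fun s => Real.sin (ω * s) • v) w ∧
      (∀ t ≤ 0, w t = Real.sin (ω * t) • v) ∧
      (∀ t, 0 ≤ t → w t = y t + D *ᵥ w (t - h)) ∧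
      IsSolution h A₀ A₁ D (fun s => ((1 - Real.cos (ω * s)) / ω) • v) X ∧
      (∀ t ≤ 0, X t = ((1 - Real.cos (ω * t)) / ω) • v) ∧
      ∀ t, 0 ≤ t → y t = A₀ *ᵥ X t + A₁ *ᵥ X (t - h) := by
  obtain ⟨w, y, hw, hw0, hy, hwy⟩ := exists_continuous_solution hh A₀ A₁ D
    (φ := fun s => Real.sin (ω * s) • v) (by fun_prop)
  set X : ℝ → Fin n → ℝ := fun t => ∫ s in (0 : ℝ)..t, w s with hX
  have hXd : ∀ t, HasDerivAt X (w t) t := fun t =>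
    intervalIntegral.integral_hasDerivAt_right (hw.intervalIntegrable _ _)
      (hw.stronglyMeasurableAtFilter _ _) hw.continuousAt
  have hXd' : ∀ t, HasDerivAt (fun s => X (s - h)) (w (t - h)) t := fun t =>
    (hXd (t - h)).comp_sub_const t h
  have hXc : Continuous X := continuous_iff_continuousAt.2 fun t => (hXd t).continuousAt
  have hX0 : ∀ t ≤ 0, X t = ((1 - Real.cos (ω * t)) / ω) • v := by
    intro t ht
    have hφ : ∀ s, HasDerivAt (fun s => ((1 - Real.cos (ω * s)) / ω) • v)
        (Real.sin (ω * s) • v) s := by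
      intro s
      have h1 : HasDerivAt (fun s => ω * s) ω s := by
        simpa using (hasDerivAt_id s).const_mul ω
      have h2 := ((h1.cos.const_sub 1).div_const ω).smul_const v
      refine h2.congr_deriv ?_
      congr 1
      field_simp
    have h3 := intervalIntegral.integral_eq_sub_of_hasDerivAt (a := 0) (b := t)
      (fun s _ => hφ s) (Continuous.intervalIntegrable (by fun_prop) _ _)
    have h4 : X t = ∫ s in (0 : ℝ)..t, Real.sin (ω * s) • v := by
      refine intervalIntegral.integral_congr fun s hs => ?_
      rw [uIcc_of_ge ht] at hs
      exact hw0 s hs.2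
    rw [h4, h3]
    simp
  have hX00 : X 0 = 0 := by simp [hX]
  have hX1 : X (-h) = 0 := by
    rw [hX0 _ (by linarith)]
    simp [hωh']
  -- The conditions on `ω h` make the data vanish at `0` and `-h`, so that `y` and `A₀ X + A₁ X(· -
  -- h)` both start at `0`; they also have the same derivative, hence agree for `t ≥ 0`.
  have hy0 : y 0 = 0 := by
    have h1 := hwy 0 le_rfl
    rw [hw0 0 le_rfl, zero_sub, hw0 (-h) (by linarith)] at h1
    simpa [hωh] using h1.symm
  have hq : ∀ t, HasDerivAt (fun t => A₀ *ᵥ X t + A₁ *ᵥ X (t - h))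
      (A₀ *ᵥ w t + A₁ *ᵥ w (t - h)) t := fun t =>
    ((mulVecCLM A₀).hasFDerivAt.comp_hasDerivAt t (hXd t)).add
      ((mulVecCLM A₁).hasFDerivAt.comp_hasDerivAt t (hXd' t))
  have hyq : ∀ t, 0 ≤ t → y t = A₀ *ᵥ X t + A₁ *ᵥ X (t - h) := by
    intro T hT
    refine eq_of_has_deriv_right_eq (a := 0) (b := T)
      (f := y) (g := fun t => A₀ *ᵥ X t + A₁ *ᵥ X (t - h))
      (f' := fun t => A₀ *ᵥ w t + A₁ *ᵥ w (t - h))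
      (fun t ht => ?_) (fun t _ => (hq t).hasDerivWithinAt)
      (fun t _ => (hy t).continuousAt.continuousWithinAt)
      (fun t _ => (hq t).continuousAt.continuousWithinAt) ?_ T ⟨hT, le_rfl⟩
    · have := hy t
      rw [← hwy t ht.1] at this
      exact this.hasDerivWithinAt
    · simp [hy0, hX1, hX00]
  refine ⟨w, y, X, isSolution_of_pair hw hw0 hy hwy, hw0, hwy, ?_, hX0, hyq⟩
  refine isSolution_of_continuous hXc hX0 fun t ht => ?_
  have h1 := (hXd t).sub ((mulVecCLM D).hasFDerivAt.comp_hasDerivAt t (hXd' t))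
  refine h1.congr_deriv ?_
  rw [← hyq t ht.le, mulVecCLM_apply, hwy t ht.le, add_sub_cancel_right]

/-- Fast oscillation suppresses the right-hand side of the equation, leaving `w(t) ≈ D w(t - h)`,
while stability bounds `w` by data of size `‖v‖` whatever the frequency. The limit of infinite
frequency transfers the exponential bound to `Dᵏ`. -/
theorem ExpStable.exists_pow_bound {h : ℝ} (hh : 0 < h) {A₀ A₁ D : Matrix (Fin n) (Fin n) ℝ}
    (hs : ExpStable h A₀ A₁ D) :
    ∃ γ : ℝ, ∃ σ > 0, ∀ (v : Fin n → ℝ) (k : ℕ), 1 ≤ k →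
      ‖(mulVecCLM D ^ k) v‖ ≤ γ * Real.exp (-σ * ((k - 1) * h)) * ‖v‖ := by
  obtain ⟨γ, hγ, σ, hσ, H⟩ := hs.exists_norm_bound hh
  refine ⟨γ, σ, hσ, fun v k hk => ?_⟩
  have hk' : (1 : ℝ) ≤ k := by exact_mod_cast hk
  obtain ⟨C, hC⟩ := exists_difference_iterate_bound hh (mulVecCLM D) k
  set a := ‖mulVecCLM A₀‖ + ‖mulVecCLM A₁‖ with ha
  have key : ∀ m : ℕ, ‖(mulVecCLM D ^ k) v‖ ≤ γ * Real.exp (-σ * ((k - 1) * h)) * ‖v‖ +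
      C * (a * ((γ + 1) * (2 / (2 * Real.pi * (m + 1) / h) * ‖v‖))) := by
    intro m
    have hm : (0 : ℝ) < m + 1 := by positivity
    set ω : ℝ := 2 * Real.pi * (m + 1) / h with hω
    have hωpos : 0 < ω := by positivity
    have hωh : ω * h = (m + 1 : ℕ) * (2 * Real.pi) := by
      rw [hω]; field_simp; push_cast; ring
    obtain ⟨w, y, X, hw, hw0, hwy, hXs, hX0, hy⟩ := exists_oscillating_solution hh A₀ A₁ D hωpos
      (by rw [hωh]; simpa using Real.sin_add_nat_mul_two_pi 0 (m + 1))
      (by rw [hωh]; exact Real.cos_nat_mul_two_pi _) v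
    have hb1 : ∀ t : ℝ, ‖Real.sin (ω * t) • v‖ ≤ ‖v‖ := fun t => by
      rw [norm_smul]
      exact mul_le_of_le_one_left (norm_nonneg _) (Real.abs_sin_le_one _)
    have hb2 : ∀ t : ℝ, ‖((1 - Real.cos (ω * t)) / ω) • v‖ ≤ 2 / ω * ‖v‖ := fun t => by
      rw [norm_smul]
      gcongr
      rw [Real.norm_eq_abs, abs_div, abs_of_pos hωpos]
      gcongr
      rw [abs_le]
      constructor <;> linarith [Real.neg_one_le_cos (ω * t), Real.cos_le_one (ω * t)]
    have hXb : ∀ t, -h ≤ t → ‖X t‖ ≤ (γ + 1) * (2 / ω * ‖v‖) := by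
      intro t ht
      have hpos : 0 ≤ 2 / ω * ‖v‖ := by positivity
      rcases le_total t 0 with h0 | h0
      · rw [hX0 t h0]
        refine (hb2 t).trans ?_
        nlinarith
      · have h1 := H _ (by fun_prop) X hXs _ (fun θ _ => hb2 θ) t h0
        have h2 : Real.exp (-σ * t) ≤ 1 := Real.exp_le_one_iff.2 (by nlinarith)
        calc ‖X t‖ ≤ γ * Real.exp (-σ * t) * (2 / ω * ‖v‖) := h1
          _ ≤ γ * 1 * (2 / ω * ‖v‖) := by gcongr
          _ ≤ _ := by nlinarith
    have hyb : ∀ t, 0 ≤ t → ‖y t‖ ≤ a * ((γ + 1) * (2 / ω * ‖v‖)) := by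
      intro t ht
      rw [hy t ht, ha, add_mul]
      refine (norm_add_le _ _).trans (add_le_add ?_ ?_)
      · exact ((mulVecCLM A₀).le_opNorm _).trans
          (mul_le_mul_of_nonneg_left (hXb t (by linarith)) (norm_nonneg _))
      · exact ((mulVecCLM A₁).le_opNorm _).trans
          (mul_le_mul_of_nonneg_left (hXb _ (by linarith)) (norm_nonneg _))
    -- The last maximum of `sin(ω s)` before `0`, where the initial function equals `v`. Since `ω h
    -- ≥ 2π`, it lies in `[-h, 0]`; the possible loss of one delay explains the `k - 1` in the
    -- exponent.
    set s₀ : ℝ := -(3 * Real.pi / 2) / ω with hs₀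
    have hs1 : ω * s₀ = Real.pi / 2 - 2 * Real.pi := by rw [hs₀]; field_simp; ring
    have hs2 : s₀ ≤ 0 := by
      rw [hs₀, neg_div]
      exact neg_nonpos.2 (by positivity)
    have hs3 : -h ≤ s₀ := by
      have : -(ω * h) ≤ ω * s₀ := by
        rw [hs1, hωh]
        push_cast
        nlinarith [Real.pi_pos, Nat.cast_nonneg (α := ℝ) m]
      nlinarith
    have hws : w s₀ = v := by
      rw [hw0 s₀ hs2, hs1, Real.sin_sub_two_pi, Real.sin_pi_div_two, one_smul]
    have hd := hC w y _ hwy hyb s₀ hs3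
    rw [hws] at hd
    have ht0 : (k - 1) * h ≤ s₀ + k * h := by linarith
    have ht1 : 0 ≤ (k - 1) * h := by nlinarith
    have hwb := H _ (by fun_prop) w hw _ (fun θ _ => hb1 θ) (s₀ + k * h) (ht1.trans ht0)
    have hexp : Real.exp (-σ * (s₀ + k * h)) ≤ Real.exp (-σ * ((k - 1) * h)) :=
      Real.exp_le_exp.2 (by nlinarith)
    calc ‖(mulVecCLM D ^ k) v‖
        ≤ ‖w (s₀ + k * h)‖ + ‖w (s₀ + k * h) - (mulVecCLM D ^ k) v‖ := norm_le_insert _ _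
      _ ≤ _ := by
        refine add_le_add (hwb.trans ?_) hd
        gcongr
  have hlim : Tendsto (fun m : ℕ => γ * Real.exp (-σ * ((k - 1) * h)) * ‖v‖ +
      C * (a * ((γ + 1) * (2 / (2 * Real.pi * (m + 1) / h) * ‖v‖)))) atTop
      (𝓝 (γ * Real.exp (-σ * ((k - 1) * h)) * ‖v‖ + C * (a * ((γ + 1) * (0 * ‖v‖))))) := by
    have h0 : Tendsto (fun m : ℕ => 2 / (2 * Real.pi * ((m : ℝ) + 1) / h)) atTop (𝓝 0) := by
      refine Tendsto.div_atTop tendsto_const_nhds ?_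
      refine Tendsto.atTop_div_const hh (Tendsto.const_mul_atTop (by positivity) ?_)
      exact tendsto_atTop_add_const_right _ _ tendsto_natCast_atTop_atTop
    exact ((((h0.mul_const _).const_mul _).const_mul _).const_mul _).const_add _
  have := ge_of_tendsto' hlim key
  simpa using this

/-- The difference operator of an exponentially stable neutral system is stable. -/
theorem ExpStable.tendsto_pow {h : ℝ} (hh : 0 < h) {A₀ A₁ D : Matrix (Fin n) (Fin n) ℝ}
    (hs : ExpStable h A₀ A₁ D) (v : Fin n → ℝ) :
    Tendsto (fun k : ℕ => (mulVecCLM D ^ k) v) atTop (𝓝 0) := by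
  obtain ⟨γ, σ, hσ, H⟩ := hs.exists_pow_bound hh
  refine squeeze_zero_norm' (a := fun k : ℕ => γ * Real.exp (-σ * ((k - 1) * h)) * ‖v‖) ?_ ?_
  · filter_upwards [eventually_ge_atTop 1] with k hk using H v k hk
  · have h1 : Tendsto (fun k : ℕ => -σ * (((k : ℝ) - 1) * h)) atTop atBot :=
      ((tendsto_atTop_add_const_right _ (-1) tendsto_natCast_atTop_atTop).atTop_mul_const
        hh).const_mul_atTop_of_neg (neg_lt_zero.2 hσ)
    simpa using ((Real.tendsto_exp_atBot.comp h1).const_mul γ).mul_const ‖v‖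

/-- Iterating `X = Dᵀ X D` gives `uᵀ X v = (Dᵏ u)ᵀ X (Dᵏ v)`, which tends to `0`. -/
theorem ExpStable.eq_zero_of_stein {h : ℝ} (hh : 0 < h) {A₀ A₁ D : Matrix (Fin n) (Fin n) ℝ}
    (hs : ExpStable h A₀ A₁ D) {X : Matrix (Fin n) (Fin n) ℝ} (hX : X - Dᵀ * X * D = 0) :
    X = 0 := by
  have hstep : ∀ u v : Fin n → ℝ, u ⬝ᵥ X *ᵥ v = (D *ᵥ u) ⬝ᵥ X *ᵥ (D *ᵥ v) := by
    intro u v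
    conv_lhs => rw [sub_eq_zero.1 hX]
    rw [← mulVec_mulVec, ← mulVec_mulVec, dotProduct_mulVec, vecMul_transpose]
  have hpow : ∀ (k : ℕ) (u v : Fin n → ℝ),
      u ⬝ᵥ X *ᵥ v = ((mulVecCLM D ^ k) u) ⬝ᵥ X *ᵥ ((mulVecCLM D ^ k) v) := by
    intro k u v
    induction k with
    | zero => simp
    | succ k ih => rw [ih, hstep, pow_succ', mul_apply_eq_comp, mul_apply_eq_comp]; rfl
  have hz : ∀ u v : Fin n → ℝ, u ⬝ᵥ X *ᵥ v = 0 := by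
    intro u v
    have hc : Continuous fun p : (Fin n → ℝ) × (Fin n → ℝ) => p.1 ⬝ᵥ X *ᵥ p.2 :=
      continuous_fst.dotProduct (continuous_const.matrix_mulVec continuous_snd)
    have h1 := (hc.tendsto (0, 0)).comp
      ((hs.tendsto_pow hh u).prodMk_nhds (hs.tendsto_pow hh v))
    have h2 : Tendsto (fun _ : ℕ => u ⬝ᵥ X *ᵥ v) atTop (𝓝 0) := by
      simpa using h1.congr fun k => (hpow k u v).symm
    exact tendsto_nhds_unique tendsto_const_nhds h2
  ext i j
  simpa using hz (Pi.single i 1) (Pi.single j 1)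

end Stability

/-! ### Entrywise calculus of matrix functions -/

section MatrixDerivative

variable {n : ℕ}

/-- Entrywise derivative of a matrix function at a point. -/
def MHasDeriv (M : ℝ → Matrix (Fin n) (Fin n) ℝ) (M' : Matrix (Fin n) (Fin n) ℝ) (t : ℝ) : Prop :=
  ∀ i j, HasDerivAt (fun s => M s i j) (M' i j) t

variable {M K : ℝ → Matrix (Fin n) (Fin n) ℝ} {M' K' : Matrix (Fin n) (Fin n) ℝ} {t : ℝ}

theorem MHasDeriv.add (hM : MHasDeriv M M' t) (hK : MHasDeriv K K' t) :
    MHasDeriv (fun s => M s + K s) (M' + K') t :=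
  fun i j => (hM i j).add (hK i j)

theorem MHasDeriv.sub (hM : MHasDeriv M M' t) (hK : MHasDeriv K K' t) :
    MHasDeriv (fun s => M s - K s) (M' - K') t :=
  fun i j => (hM i j).sub (hK i j)

theorem MHasDeriv.linear (hM : MHasDeriv M M' t)
    (l : Matrix (Fin n) (Fin n) ℝ →ₗ[ℝ] Matrix (Fin n) (Fin n) ℝ) :
    MHasDeriv (fun s => l (M s)) (l M') t := by
  have h1 : HasDerivAt (fun s => ((ofLinearEquiv ℝ).symm (M s) : Fin n → Fin n → ℝ))
      ((ofLinearEquiv ℝ).symm M') t :=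
    hasDerivAt_pi.2 fun i => hasDerivAt_pi.2 fun j => hM i j
  have h2 := (LinearMap.toContinuousLinearMap
    (((ofLinearEquiv ℝ).symm.toLinearMap ∘ₗ l) ∘ₗ
      (ofLinearEquiv (m := Fin n) (n := Fin n) (α := ℝ) ℝ).toLinearMap)).hasFDerivAt.comp_hasDerivAt
        t h1
  intro i j
  exact hasDerivAt_pi.1 (hasDerivAt_pi.1 h2 i) j

theorem MHasDeriv.transpose (hM : MHasDeriv M M' t) : MHasDeriv (fun s => (M s)ᵀ) M'ᵀ t :=
  fun i j => hM j i

theorem MHasDeriv.const_mul (hM : MHasDeriv M M' t) (A : Matrix (Fin n) (Fin n) ℝ) :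
    MHasDeriv (fun s => A * M s) (A * M') t :=
  hM.linear (LinearMap.mulLeft ℝ A)

theorem MHasDeriv.mul_const (hM : MHasDeriv M M' t) (A : Matrix (Fin n) (Fin n) ℝ) :
    MHasDeriv (fun s => M s * A) (M' * A) t :=
  hM.linear (LinearMap.mulRight ℝ A)

theorem MHasDeriv.comp_const_sub {a : ℝ} (hM : MHasDeriv M M' (a - t)) :
    MHasDeriv (fun s => M (a - s)) (-M') t := fun i j => by
  simpa using (hM i j).comp_const_sub a t

theorem MHasDeriv.mderiv (hM : MHasDeriv M M' t) : mderiv M t = M' := by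
  ext i j
  exact (hM i j).deriv

theorem MHasDeriv.congr (hM : MHasDeriv M M' t) (h : K =ᶠ[𝓝 t] M) : MHasDeriv K M' t :=
  fun i j => (hM i j).congr_of_eventuallyEq (h.mono fun s hs => by simp only [hs])

theorem MHasDeriv.unique (hM : MHasDeriv M M' t) (hM' : MHasDeriv M K' t) : M' = K' := by
  ext i j
  exact (hM i j).unique (hM' i j)

theorem continuous_of_mHasDeriv {M' : ℝ → Matrix (Fin n) (Fin n) ℝ}
    (hM : ∀ t, MHasDeriv M (M' t) t) : Continuous M :=
  continuous_matrix fun i j => continuous_iff_continuousAt.2 fun t => (hM t i j).continuousAt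

theorem continuous_linear (l : Matrix (Fin n) (Fin n) ℝ →ₗ[ℝ] Matrix (Fin n) (Fin n) ℝ) :
    Continuous l := l.continuous_of_finiteDimensional

end MatrixDerivative

/-! ### Smoothness of the delay Lyapunov matrix -/

section Regularity

variable {n : ℕ}

/-- `V` is a twice continuously differentiable matrix function on the line, with derivatives `V₁`
and `V₂`, which satisfies the equations of the delay Lyapunov matrix on `[0, h]`. -/
structure IsSmoothLyapunov (h : ℝ) (A₀ A₁ D W P : Matrix (Fin n) (Fin n) ℝ)
    (V V₁ V₂ : ℝ → Matrix (Fin n) (Fin n) ℝ) : Prop where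
  deriv₁ : ∀ t, MHasDeriv V (V₁ t) t
  deriv₂ : ∀ t, MHasDeriv V₁ (V₂ t) t
  continuous₂ : Continuous V₂
  symm_zero : (V 0)ᵀ = V 0
  dynamic : ∀ θ ∈ Icc 0 h,
    (V₁ θ)ᵀ + Dᵀ * V₁ (h - θ) = A₀ᵀ * (V θ)ᵀ + A₁ᵀ * V (h - θ)
  dynamic' : ∀ θ ∈ Icc 0 h,
    (V₂ θ)ᵀ - Dᵀ * V₂ (h - θ) = A₀ᵀ * (V₁ θ)ᵀ - A₁ᵀ * V₁ (h - θ)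
  jump : V₁ 0 + (V₁ 0)ᵀ = P
  algebraic : P - Dᵀ * P * D = -W

theorem IsSmoothLyapunov.continuous₀ {h : ℝ} {A₀ A₁ D W P : Matrix (Fin n) (Fin n) ℝ}
    {V V₁ V₂ : ℝ → Matrix (Fin n) (Fin n) ℝ} (hV : IsSmoothLyapunov h A₀ A₁ D W P V V₁ V₂) :
    Continuous V := continuous_of_mHasDeriv hV.deriv₁

theorem IsSmoothLyapunov.continuous₁ {h : ℝ} {A₀ A₁ D W P : Matrix (Fin n) (Fin n) ℝ}
    {V V₁ V₂ : ℝ → Matrix (Fin n) (Fin n) ℝ} (hV : IsSmoothLyapunov h A₀ A₁ D W P V V₁ V₂) :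
    Continuous V₁ := continuous_of_mHasDeriv hV.deriv₂

/-- The delay Lyapunov matrix `U` coincides on `[-h, h]` with the symmetric extension of `V`. -/
structure IsExtension (h : ℝ) (U V V₁ V₂ : ℝ → Matrix (Fin n) (Fin n) ℝ) : Prop where
  nonneg : ∀ θ ∈ Icc 0 h, U θ = V θ
  nonpos : ∀ θ ∈ Icc (-h) 0, U θ = (V (-θ))ᵀ
  deriv_pos : ∀ θ ∈ Ioo 0 h, mderiv U θ = V₁ θ
  deriv_neg : ∀ θ ∈ Ioo (-h) 0, mderiv U θ = -(V₁ (-θ))ᵀ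
  deriv₂_pos : ∀ θ ∈ Ioo 0 h, mderiv (mderiv U) θ = V₂ θ
  deriv₂_neg : ∀ θ ∈ Ioo (-h) 0, mderiv (mderiv U) θ = (V₂ (-θ))ᵀ

variable {h : ℝ} {A₀ A₁ D W P : Matrix (Fin n) (Fin n) ℝ} {U : ℝ → Matrix (Fin n) (Fin n) ℝ}

theorem IsDelayLyapunovMatrix.mHasDeriv (hU : IsDelayLyapunovMatrix h A₀ A₁ D W U P) {θ : ℝ}
    (hθ : θ ∈ Ioo 0 h) : MHasDeriv U (mderiv U θ) θ :=
  fun i j => (hU.differentiable θ hθ i j).1.hasDerivAt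

theorem IsDelayLyapunovMatrix.mderiv_neg (hU : IsDelayLyapunovMatrix h A₀ A₁ D W U P) {θ : ℝ}
    (hθ : θ ∈ Ioo 0 h) : mderiv U (-θ) = -(mderiv U θ)ᵀ := by
  refine MHasDeriv.mderiv ?_
  have h1 : MHasDeriv (fun s => (U (0 - s))ᵀ) (-mderiv U θ)ᵀ (-θ) := by
    refine (MHasDeriv.comp_const_sub ?_).transpose
    simpa using hU.mHasDeriv hθ
  refine h1.congr ?_
  filter_upwards [Ioo_mem_nhds (a := -h) (b := 0) (by linarith [hθ.2]) (by linarith [hθ.1])]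
    with s hs
  have := hU.symmetry s ⟨hs.1.le, by linarith [hs.1, hs.2]⟩
  rw [zero_sub, ← this, transpose_transpose]

/-- On `(0, h)` the derivative of `U` is a linear function of `U(θ)` and `U(h - θ)`. -/
theorem IsDelayLyapunovMatrix.exists_linear (hh : 0 < h)
    (hU : IsDelayLyapunovMatrix h A₀ A₁ D W U P) (hs : ExpStable h A₀ A₁ D) :
    ∃ l₁ l₂ : Matrix (Fin n) (Fin n) ℝ →ₗ[ℝ] Matrix (Fin n) (Fin n) ℝ,
      ∀ θ ∈ Ioo 0 h, mderiv U θ = l₁ (U θ) + l₂ (U (h - θ)) := by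
  -- The equation at `θ` and the transposed equation at `h - θ` involve only `U'(θ)` and `U'(h -
  -- θ)ᵀ`. Eliminating the latter leaves `S (U'(θ))` on the left, and `S` is invertible because it
  -- is injective on a finite-dimensional space.
  let S : Matrix (Fin n) (Fin n) ℝ →ₗ[ℝ] Matrix (Fin n) (Fin n) ℝ :=
    LinearMap.id - (LinearMap.mulRight ℝ D) ∘ₗ (LinearMap.mulLeft ℝ Dᵀ)
  have hS : ∀ X, S X = X - Dᵀ * X * D := fun X => rfl
  have hinj : Function.Injective S := by
    rw [injective_iff_map_eq_zero]
    intro X hX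
    exact hs.eq_zero_of_stein hh ((hS X).symm.trans hX)
  let e := LinearEquiv.ofInjectiveEndo S hinj
  let tr : Matrix (Fin n) (Fin n) ℝ →ₗ[ℝ] Matrix (Fin n) (Fin n) ℝ :=
    (transposeLinearEquiv (Fin n) (Fin n) ℝ ℝ).toLinearMap
  refine ⟨e.symm.toLinearMap ∘ₗ (LinearMap.mulRight ℝ A₀ -
      (LinearMap.mulRight ℝ D) ∘ₗ (LinearMap.mulLeft ℝ A₁ᵀ)),
    e.symm.toLinearMap ∘ₗ (LinearMap.mulRight ℝ A₁ -
      (LinearMap.mulRight ℝ D) ∘ₗ (LinearMap.mulLeft ℝ A₀ᵀ)) ∘ₗ tr, fun θ hθ => ?_⟩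
  have hθ' : h - θ ∈ Ioo 0 h := ⟨by linarith [hθ.2], by linarith [hθ.1]⟩
  have d1 := hU.dynamic θ hθ
  have d2 := hU.dynamic (h - θ) hθ'
  have n1 := hU.mderiv_neg hθ'
  have n2 := hU.mderiv_neg hθ
  have s1 := hU.symmetry (h - θ) ⟨by linarith [hθ.2], by linarith [hθ.1]⟩
  have s2 := hU.symmetry θ ⟨by linarith [hθ.1], hθ.2.le⟩
  rw [neg_sub] at n1 s1
  rw [show h - θ - h = -θ by ring, n2, ← s2] at d2
  rw [n1, ← s1] at d1
  have d2' := congrArg Matrix.transpose d2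
  simp only [transpose_sub, transpose_mul, transpose_neg, transpose_transpose, transpose_add]
    at d2'
  have key : S (mderiv U θ) = (U θ * A₀ - A₁ᵀ * U θ * D) +
      ((U (h - θ))ᵀ * A₁ - A₀ᵀ * (U (h - θ))ᵀ * D) := by
    have e1 : (mderiv U (h - θ))ᵀ = A₀ᵀ * (U (h - θ))ᵀ + A₁ᵀ * U θ - Dᵀ * mderiv U θ := by
      rw [← d2']
      noncomm_ring
    rw [e1] at d1
    have e2 : mderiv U θ = U θ * A₀ + (U (h - θ))ᵀ * A₁ +
      -(A₀ᵀ * (U (h - θ))ᵀ + A₁ᵀ * U θ - Dᵀ * mderiv U θ) * D := by rw [← d1]; noncomm_ring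
    rw [hS]
    nth_rewrite 1 [e2]
    noncomm_ring
  have h3 : mderiv U θ = e.symm (S (mderiv U θ)) := (e.symm_apply_apply _).symm
  rw [h3, key, map_add]
  rfl

/-- Integrating the formula for `U'` extends `U` from `[0, h]` to the line with one more derivative
than `C`. The freedom in `C`, any continuous extension of `U`, allows the lemma to be fed with its
own output. -/
theorem exists_primitive_extension (hU : ContinuousOn U (Icc 0 h))
    (hd : ∀ θ ∈ Ioo 0 h, MHasDeriv U (mderiv U θ) θ)
    {l₁ l₂ : Matrix (Fin n) (Fin n) ℝ →ₗ[ℝ] Matrix (Fin n) (Fin n) ℝ}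
    (hl : ∀ θ ∈ Ioo 0 h, mderiv U θ = l₁ (U θ) + l₂ (U (h - θ)))
    {C : ℝ → Matrix (Fin n) (Fin n) ℝ} (hC : Continuous C) (hCU : ∀ θ ∈ Icc 0 h, C θ = U θ) :
    ∃ V : ℝ → Matrix (Fin n) (Fin n) ℝ, (∀ θ ∈ Icc 0 h, V θ = U θ) ∧
      ∀ t, MHasDeriv V (l₁ (C t) + l₂ (C (h - t))) t := by
  have hc : Continuous fun t => l₁ (C t) + l₂ (C (h - t)) :=
    ((continuous_linear l₁).comp hC).add
      ((continuous_linear l₂).comp (hC.comp (continuous_const.sub continuous_id)))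
  have hce : ∀ i j, Continuous fun t => (l₁ (C t) + l₂ (C (h - t))) i j :=
    fun i j => hc.matrix_elem i j
  refine ⟨fun θ => Matrix.of fun i j => U 0 i j +
    ∫ s in (0 : ℝ)..θ, (l₁ (C s) + l₂ (C (h - s))) i j, fun θ hθ => ?_, fun t i j => ?_⟩
  · ext i j
    have h1 := intervalIntegral.integral_eq_sub_of_hasDerivAt_of_le hθ.1
      (f := fun s => U s i j) (f' := fun s => (l₁ (C s) + l₂ (C (h - s))) i j)
      (fun s hs => by
        have := hU s ⟨hs.1, hs.2.trans hθ.2⟩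
        exact (((continuous_id.matrix_elem i j).continuousAt.comp_continuousWithinAt
          this).mono (Icc_subset_Icc_right hθ.2)))
      (fun s hs => by
        have hs' : s ∈ Ioo 0 h := ⟨hs.1, hs.2.trans_le hθ.2⟩
        rw [hCU s (Ioo_subset_Icc_self hs'),
          hCU (h - s) ⟨by linarith [hs'.2], by linarith [hs'.1]⟩, ← hl s hs']
        exact hd s hs' i j) ((hce i j).intervalIntegrable _ _)
    exact (congrArg (U 0 i j + ·) h1).trans (add_sub_cancel _ _)
  · exact (intervalIntegral.integral_hasDerivAt_right ((hce i j).intervalIntegrable _ _)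
      ((hce i j).stronglyMeasurableAtFilter _ _) (hce i j).continuousAt).const_add _

theorem eqOn_Icc_of_eqOn_Ioo (hh : 0 < h) {F G : ℝ → Matrix (Fin n) (Fin n) ℝ}
    (hF : Continuous F) (hG : Continuous G) (hFG : ∀ θ ∈ Ioo 0 h, F θ = G θ) :
    ∀ θ ∈ Icc 0 h, F θ = G θ := by
  have : Icc 0 h ⊆ {θ | F θ = G θ} := by
    rw [← closure_Ioo hh.ne]
    exact closure_minimal hFG (isClosed_eq hF hG)
  exact this

theorem IsDelayLyapunovMatrix.exists_smooth (hh : 0 < h)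
    (hU : IsDelayLyapunovMatrix h A₀ A₁ D W U P) (hs : ExpStable h A₀ A₁ D) :
    ∃ V V₁ V₂ : ℝ → Matrix (Fin n) (Fin n) ℝ,
      IsSmoothLyapunov h A₀ A₁ D W P V V₁ V₂ ∧ IsExtension h U V V₁ V₂ := by
  obtain ⟨l₁, l₂, hl⟩ := hU.exists_linear hh hs
  have hcont : ContinuousOn U (Icc 0 h) :=
    hU.continuousOn.mono (Icc_subset_Icc_left (by linarith))
  obtain ⟨Va, hVa, hVad⟩ := exists_primitive_extension hcont (fun θ hθ => hU.mHasDeriv hθ) hl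
    (C := IccExtend hh.le ((Icc 0 h).domRestrict U))
    ((continuousOn_iff_continuous_domRestrict.1 hcont).Icc_extend')
    (fun θ hθ => by rw [IccExtend_of_mem _ _ hθ]; rfl)
  set Va' := fun t => l₁ (IccExtend hh.le ((Icc 0 h).domRestrict U) t) +
    l₂ (IccExtend hh.le ((Icc 0 h).domRestrict U) (h - t)) with hVa'
  have hVa'c : Continuous Va' := by
    have hC := (continuousOn_iff_continuous_domRestrict.1 hcont).Icc_extend' (h := hh.le)
    exact ((continuous_linear l₁).comp hC).add
      ((continuous_linear l₂).comp (hC.comp (continuous_const.sub continuous_id)))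
  -- Second pass: the derivative of `V` is now built from the differentiable `Va` instead of the
  -- constant extension of `U`, so `V` is `C²`.
  obtain ⟨V, hV, hVd⟩ := exists_primitive_extension hcont (fun θ hθ => hU.mHasDeriv hθ) hl
    (continuous_of_mHasDeriv hVad) hVa
  set V₁ := fun t => l₁ (Va t) + l₂ (Va (h - t)) with hV₁
  have hV₁d : ∀ t, MHasDeriv V₁ (l₁ (Va' t) + l₂ (-Va' (h - t))) t := fun t =>
    ((hVad t).linear l₁).add ((hVad (h - t)).comp_const_sub.linear l₂)
  set V₂ := fun t => l₁ (Va' t) + l₂ (-Va' (h - t)) with hV₂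
  have hV₂c : Continuous V₂ := ((continuous_linear l₁).comp hVa'c).add
      ((continuous_linear l₂).comp (hVa'c.comp (continuous_const.sub continuous_id)).neg)
  have hVc : Continuous V := continuous_of_mHasDeriv hVd
  have hV₁c : Continuous V₁ := continuous_of_mHasDeriv hV₁d
  have hpos : ∀ θ ∈ Ioo 0 h, mderiv U θ = V₁ θ := fun θ hθ => by
    refine ((hVd θ).congr ?_).mderiv
    filter_upwards [Ioo_mem_nhds hθ.1 hθ.2] with s hs using (hV s (Ioo_subset_Icc_self hs)).symm
  have hneg : ∀ θ ∈ Ioo (-h) 0, mderiv U θ = -(V₁ (-θ))ᵀ := fun θ hθ => by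
    have hθ' : -θ ∈ Ioo 0 h := ⟨by linarith [hθ.2], by linarith [hθ.1]⟩
    rw [← hpos _ hθ', ← hU.mderiv_neg hθ', neg_neg]
  have hdyn : ∀ θ ∈ Ioo 0 h,
      (V₁ θ)ᵀ + Dᵀ * V₁ (h - θ) = A₀ᵀ * (V θ)ᵀ + A₁ᵀ * V (h - θ) := fun θ hθ => by
    have hθ' : h - θ ∈ Ioo 0 h := ⟨by linarith [hθ.2], by linarith [hθ.1]⟩
    have d1 := hU.dynamic θ hθ
    have n1 := hU.mderiv_neg hθ'
    have s1 := hU.symmetry (h - θ) ⟨by linarith [hθ.2], by linarith [hθ.1]⟩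
    rw [neg_sub] at n1 s1
    rw [n1, ← s1, hpos _ hθ, hpos _ hθ', ← hV _ (Ioo_subset_Icc_self hθ),
      ← hV _ (Ioo_subset_Icc_self hθ')] at d1
    have d2 := congrArg Matrix.transpose d1
    simpa using d2
  have hsubc : Continuous fun θ : ℝ => h - θ := continuous_const.sub continuous_id
  refine ⟨V, V₁, V₂, ⟨hVd, hV₁d, hV₂c, ?_, ?_, ?_, ?_, hU.algebraic⟩,
    ⟨fun θ hθ => (hV θ hθ).symm, fun θ hθ => ?_, hpos, hneg, fun θ hθ => ?_, fun θ hθ => ?_⟩⟩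
  · rw [hV 0 ⟨le_rfl, hh.le⟩, hU.symmetry 0 ⟨by linarith, hh.le⟩, neg_zero]
  · exact eqOn_Icc_of_eqOn_Ioo hh
      (hV₁c.matrix_transpose.add (continuous_const.matrix_mul (hV₁c.comp hsubc)))
      ((continuous_const.matrix_mul hVc.matrix_transpose).add
        (continuous_const.matrix_mul (hVc.comp hsubc))) hdyn
  · refine eqOn_Icc_of_eqOn_Ioo hh
      (hV₂c.matrix_transpose.sub (continuous_const.matrix_mul (hV₂c.comp hsubc)))
      ((continuous_const.matrix_mul hV₁c.matrix_transpose).sub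
        (continuous_const.matrix_mul (hV₁c.comp hsubc))) fun θ hθ => ?_
    -- The second-order relation is the derivative of `hdyn`, available only in the open interval;
    -- continuity of `V₁` and `V₂` carries it to the endpoints.
    have e1 := (hV₁d θ).transpose.add ((hV₁d (h - θ)).comp_const_sub.const_mul Dᵀ)
    have e2 := ((hVd θ).transpose.const_mul A₀ᵀ).add ((hVd (h - θ)).comp_const_sub.const_mul A₁ᵀ)
    have e3 := e1.unique (e2.congr (by
      filter_upwards [Ioo_mem_nhds hθ.1 hθ.2] with s hs using hdyn s hs))
    simpa only [mul_neg, ← sub_eq_add_neg] using e3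
  · have h1 : Tendsto (fun θ => V₁ θ + (V₁ θ)ᵀ) (𝓝[>] 0) (𝓝 (V₁ 0 + (V₁ 0)ᵀ)) :=
      ((hV₁c.add hV₁c.matrix_transpose).tendsto 0).mono_left nhdsWithin_le_nhds
    refine tendsto_nhds_unique (h1.congr' ?_) hU.jump
    filter_upwards [Ioo_mem_nhdsGT hh] with θ hθ
    rw [hU.mderiv_neg hθ, hpos θ hθ, sub_neg_eq_add]
  · have h1 := hU.symmetry θ ⟨hθ.1, by linarith [hθ.2]⟩
    rw [hV _ ⟨by linarith [hθ.2], by linarith [hθ.1]⟩, ← h1, transpose_transpose]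
  · refine ((hV₁d θ).congr ?_).mderiv
    filter_upwards [Ioo_mem_nhds hθ.1 hθ.2] with s hs using hpos s hs
  · have e : MHasDeriv (fun s => -(V₁ (0 - s))ᵀ) (V₂ (-θ))ᵀ θ := by
      have hd : ∀ t, MHasDeriv V₁ (V₂ t) t := hV₁d
      have := (hd (0 - θ)).comp_const_sub.transpose.linear (-LinearMap.id)
      simpa using this
    refine (e.congr ?_).mderiv
    filter_upwards [Ioo_mem_nhds hθ.1 hθ.2] with s hs
    rw [hneg s hs, zero_sub]

end Regularity

/-! ### The functional with continuous kernels: derivative and limits -/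

section SmoothFunctional

variable {n : ℕ}

theorem hasDerivAt_dotProduct {u v : ℝ → Fin n → ℝ} {u' v' : Fin n → ℝ} {t : ℝ}
    (hu : HasDerivAt u u' t) (hv : HasDerivAt v v' t) :
    HasDerivAt (fun t => u t ⬝ᵥ v t) (u' ⬝ᵥ v t + u t ⬝ᵥ v') t := by
  have := HasDerivAt.fun_sum (u := Finset.univ) fun i _ =>
    (hasDerivAt_pi.1 hu i).mul (hasDerivAt_pi.1 hv i)
  refine this.congr_deriv ?_
  simp [dotProduct, Finset.sum_add_distrib]

theorem MHasDeriv.mulVec_const {M : ℝ → Matrix (Fin n) (Fin n) ℝ}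
    {M' : Matrix (Fin n) (Fin n) ℝ} {t : ℝ} (hM : MHasDeriv M M' t) (v : Fin n → ℝ) :
    HasDerivAt (fun t => M t *ᵥ v) (M' *ᵥ v) t :=
  hasDerivAt_pi.2 fun i => show HasDerivAt (fun t => ∑ j, M t i j * v j) (∑ j, M' i j * v j) t from
    HasDerivAt.fun_sum fun j _ => (hM i j).mul_const (v j)

theorem continuous_bilin {X : Type*} [TopologicalSpace X] {u v : X → Fin n → ℝ}
    {M : X → Matrix (Fin n) (Fin n) ℝ} (hu : Continuous u) (hM : Continuous M)
    (hv : Continuous v) : Continuous fun x => u x ⬝ᵥ M x *ᵥ v x :=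
  hu.dotProduct (hM.matrix_mulVec hv)

/-- The Lyapunov functional written with continuous kernels: `V₀` for the vector, `N` for the mixed
term, `M₁`, `M₂` for the double integral below and above the diagonal, `R` for the single
integral. -/
def smoothFunctional (h : ℝ) (V₀ R : Matrix (Fin n) (Fin n) ℝ)
    (N M₁ M₂ : ℝ → Matrix (Fin n) (Fin n) ℝ) (ξ : Fin n → ℝ) (φ : ℝ → Fin n → ℝ) : ℝ :=
  ξ ⬝ᵥ V₀ *ᵥ ξ + 2 * (∫ θ in (-h)..0, ξ ⬝ᵥ N (h + θ) *ᵥ φ θ)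
    + triInt (-h) 0 (fun a b => φ a ⬝ᵥ M₁ (a - b) *ᵥ φ b) (fun a b => φ a ⬝ᵥ M₂ (b - a) *ᵥ φ b)
    - ∫ θ in (-h)..0, φ θ ⬝ᵥ R *ᵥ φ θ

theorem triInt_comp_add (a c t : ℝ) (k₁ k₂ : ℝ → ℝ → ℝ) :
    triInt a c (fun s r => k₁ (t + s) (t + r)) (fun s r => k₂ (t + s) (t + r)) =
      triInt (t + a) (t + c) k₁ k₂ := by
  unfold triInt
  rw [← intervalIntegral.integral_comp_add_left]
  refine intervalIntegral.integral_congr fun s _ => ?_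
  simp only [intervalIntegral.integral_comp_add_left (fun r => k₁ (t + s) r),
    intervalIntegral.integral_comp_add_left (fun r => k₂ (t + s) r)]

/-- After the substitution `s = t + θ`, the time no longer sits inside the argument of `x` under the
integrals. Solutions are only known to be continuous, so this form is the one that can be
differentiated. -/
theorem smoothFunctional_shift (h : ℝ) (V₀ R : Matrix (Fin n) (Fin n) ℝ)
    (N M₁ M₂ : ℝ → Matrix (Fin n) (Fin n) ℝ) (ξ : Fin n → ℝ) (x : ℝ → Fin n → ℝ) (t : ℝ) :
    smoothFunctional h V₀ R N M₁ M₂ ξ (fun θ => x (t + θ)) =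
      ξ ⬝ᵥ V₀ *ᵥ ξ + 2 * (∫ s in (t - h)..t, ξ ⬝ᵥ N (s - (t - h)) *ᵥ x s)
        + triInt (t - h) t (fun a b => x a ⬝ᵥ M₁ (a - b) *ᵥ x b)
          (fun a b => x a ⬝ᵥ M₂ (b - a) *ᵥ x b)
        - ∫ s in (t - h)..t, x s ⬝ᵥ R *ᵥ x s := by
  have e1 := intervalIntegral.integral_comp_add_left (a := -h) (b := 0)
    (fun s => ξ ⬝ᵥ N (s - (t - h)) *ᵥ x s) t
  have e2 := intervalIntegral.integral_comp_add_left (a := -h) (b := 0)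
    (fun s => x s ⬝ᵥ R *ᵥ x s) t
  have e3 := triInt_comp_add (-h) 0 t (fun a b => x a ⬝ᵥ M₁ (a - b) *ᵥ x b)
    (fun a b => x a ⬝ᵥ M₂ (b - a) *ᵥ x b)
  simp only [add_zero, ← sub_eq_add_neg, add_sub_add_left_eq_sub] at e1 e2 e3
  unfold smoothFunctional
  rw [← e1, ← e2, ← e3]
  congr 4
  refine intervalIntegral.integral_congr fun θ _ => ?_
  simp only
  rw [show t + θ - (t - h) = h + θ by ring]

/-- Only `y` and the mixed kernel `N` are differentiated; `x` and the kernels of the double integral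
enter through boundary values. All remaining integrals are over one variable and share the range `[t
- h, t]`, so they are collected into one integrand. -/
theorem hasDerivAt_smoothFunctional {h : ℝ} {V₀ R : Matrix (Fin n) (Fin n) ℝ}
    {N N' M₁ M₂ : ℝ → Matrix (Fin n) (Fin n) ℝ} (hN : ∀ t, MHasDeriv N (N' t) t)
    (hN' : Continuous N') (h₁ : Continuous M₁) (h₂ : Continuous M₂)
    {x y y' : ℝ → Fin n → ℝ} (hx : Continuous x) (hy : ∀ t, HasDerivAt y (y' t) t)
    (hy' : Continuous y') (t : ℝ) :
    HasDerivAt (fun t => smoothFunctional h V₀ R N M₁ M₂ (y t) (fun θ => x (t + θ)))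
      (y' t ⬝ᵥ V₀ *ᵥ y t + y t ⬝ᵥ V₀ *ᵥ y' t
        + 2 * (y t ⬝ᵥ N h *ᵥ x t - y t ⬝ᵥ N 0 *ᵥ x (t - h))
        - (x t ⬝ᵥ R *ᵥ x t - x (t - h) ⬝ᵥ R *ᵥ x (t - h))
        + ∫ s in (t - h)..t, (2 * (y' t ⬝ᵥ N (s - (t - h)) *ᵥ x s
              - y t ⬝ᵥ N' (s - (t - h)) *ᵥ x s)
            + (x t ⬝ᵥ M₁ (t - s) *ᵥ x s - x (t - h) ⬝ᵥ M₂ (s - (t - h)) *ᵥ x s)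
            + (x s ⬝ᵥ M₂ (t - s) *ᵥ x t - x s ⬝ᵥ M₁ (s - (t - h)) *ᵥ x (t - h)))) t := by
  have hyc : Continuous y := continuous_iff_continuousAt.2 fun t => (hy t).continuousAt
  have hNc : Continuous N := continuous_of_mHasDeriv hN
  have hsub : HasDerivAt (fun t => t - h) 1 t := (hasDerivAt_id t).sub_const h
  have c1 : Continuous fun p : ℝ × ℝ => p.2 - (p.1 - h) := by fun_prop
  have c2 : Continuous fun p : ℝ × ℝ => p.1 - p.2 := by fun_prop
  have c3 : Continuous fun p : ℝ × ℝ => p.2 - p.1 := by fun_prop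
  have d1 := hasDerivAt_dotProduct (hy t) ((mulVecCLM V₀).hasFDerivAt.comp_hasDerivAt t (hy t))
  have d2 := (hasDerivAt_integral_param
    (f := fun t s => y t ⬝ᵥ N (s - (t - h)) *ᵥ x s)
    (f' := fun t s => y' t ⬝ᵥ N (s - (t - h)) *ᵥ x s - y t ⬝ᵥ N' (s - (t - h)) *ᵥ x s)
    (continuous_bilin (hyc.comp continuous_fst) (hNc.comp c1) (hx.comp continuous_snd))
    ((continuous_bilin (hy'.comp continuous_fst) (hNc.comp c1) (hx.comp continuous_snd)).sub
      (continuous_bilin (hyc.comp continuous_fst) (hN'.comp c1) (hx.comp continuous_snd)))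
    (fun t s => by
      have hn : MHasDeriv (fun t => N (s + h - t)) (-N' (s + h - t)) t :=
        (hN (s + h - t)).comp_const_sub
      have := hasDerivAt_dotProduct (hy t) (hn.mulVec_const (x s))
      simp only [show ∀ t, s + h - t = s - (t - h) from fun t => by ring] at this
      refine this.congr_deriv ?_
      rw [neg_mulVec, dotProduct_neg, ← sub_eq_add_neg]) hsub (hasDerivAt_id t)).const_mul 2
  have d3 := hasDerivAt_triInt (k₁ := fun a b => x a ⬝ᵥ M₁ (a - b) *ᵥ x b)
    (k₂ := fun a b => x a ⬝ᵥ M₂ (b - a) *ᵥ x b)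
    (continuous_bilin (hx.comp continuous_fst) (h₁.comp c2) (hx.comp continuous_snd))
    (continuous_bilin (hx.comp continuous_fst) (h₂.comp c3) (hx.comp continuous_snd)) h t
  have hR : Continuous fun s => x s ⬝ᵥ R *ᵥ x s := continuous_bilin hx continuous_const hx
  have d4 := hasDerivAt_integral_param (f := fun _ s => x s ⬝ᵥ R *ᵥ x s) (f' := fun _ _ => 0)
    (hR.comp continuous_snd) continuous_const (fun t s => hasDerivAt_const _ _) hsub
    (hasDerivAt_id t)
  have d := ((d1.add d2).add d3).sub d4
  simp only [smoothFunctional_shift]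
  refine d.congr_deriv ?_
  have k1 : Continuous fun s : ℝ => s - (t - h) := by fun_prop
  have k2 : Continuous fun s : ℝ => t - s := by fun_prop
  have i1 : Continuous fun s => 2 * (y' t ⬝ᵥ N (s - (t - h)) *ᵥ x s
      - y t ⬝ᵥ N' (s - (t - h)) *ᵥ x s) :=
    continuous_const.mul ((continuous_bilin continuous_const (hNc.comp k1) hx).sub
      (continuous_bilin continuous_const (hN'.comp k1) hx))
  have i2 : Continuous fun s => x t ⬝ᵥ M₁ (t - s) *ᵥ x s :=
    continuous_bilin continuous_const (h₁.comp k2) hx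
  have i3 : Continuous fun s => x (t - h) ⬝ᵥ M₂ (s - (t - h)) *ᵥ x s :=
    continuous_bilin continuous_const (h₂.comp k1) hx
  have i4 : Continuous fun s => x s ⬝ᵥ M₂ (t - s) *ᵥ x t
      - x s ⬝ᵥ M₁ (s - (t - h)) *ᵥ x (t - h) :=
    (continuous_bilin hx (h₂.comp k2) continuous_const).sub
      (continuous_bilin hx (h₁.comp k1) continuous_const)
  have i23 : Continuous fun s => x t ⬝ᵥ M₁ (t - s) *ᵥ x s
      - x (t - h) ⬝ᵥ M₂ (s - (t - h)) *ᵥ x s := i2.sub i3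
  have i123 : Continuous fun s => 2 * (y' t ⬝ᵥ N (s - (t - h)) *ᵥ x s
      - y t ⬝ᵥ N' (s - (t - h)) *ᵥ x s) + (x t ⬝ᵥ M₁ (t - s) *ᵥ x s
      - x (t - h) ⬝ᵥ M₂ (s - (t - h)) *ᵥ x s) := i1.add i23
  rw [intervalIntegral.integral_add (i123.intervalIntegrable _ _) (i4.intervalIntegrable _ _),
    intervalIntegral.integral_add (i1.intervalIntegrable _ _) (i23.intervalIntegrable _ _),
    intervalIntegral.integral_sub (i2.intervalIntegrable _ _) (i3.intervalIntegrable _ _),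
    intervalIntegral.integral_const_mul]
  simp
  ring

theorem exists_bilin_bound {M : ℝ → Matrix (Fin n) (Fin n) ℝ} (hM : Continuous M) (B h : ℝ) :
    ∃ C : ℝ, ∀ (u v : Fin n → ℝ) (r : ℝ), ‖u‖ ≤ B → ‖v‖ ≤ B → |r| ≤ h →
      ‖u ⬝ᵥ M r *ᵥ v‖ ≤ C := by
  have hc : Continuous fun p : (Fin n → ℝ) × (Fin n → ℝ) × ℝ => p.1 ⬝ᵥ M p.2.2 *ᵥ p.2.1 :=
    continuous_bilin continuous_fst (hM.comp (continuous_snd.comp continuous_snd))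
      (continuous_fst.comp continuous_snd)
  have hK : IsCompact ((Metric.closedBall (0 : Fin n → ℝ) B) ×ˢ
      ((Metric.closedBall (0 : Fin n → ℝ) B) ×ˢ (Metric.closedBall (0 : ℝ) h))) :=
    (isCompact_closedBall _ _).prod ((isCompact_closedBall _ _).prod (isCompact_closedBall _ _))
  obtain ⟨C, hC⟩ := hK.exists_bound_of_continuousOn hc.continuousOn
  exact ⟨C, fun u v r hu hv hr => hC (u, v, r) ⟨by simpa using hu, by simpa using hv,
    by simpa using hr⟩⟩

theorem tendsto_bilin {ι : Type*} {l : Filter ι} {u v : ι → Fin n → ℝ} {u₀ v₀ : Fin n → ℝ}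
    (hu : Tendsto u l (𝓝 u₀)) (hv : Tendsto v l (𝓝 v₀)) (M : Matrix (Fin n) (Fin n) ℝ) :
    Tendsto (fun k => u k ⬝ᵥ M *ᵥ v k) l (𝓝 (u₀ ⬝ᵥ M *ᵥ v₀)) :=
  ((continuous_bilin continuous_fst (continuous_const (y := M)) continuous_snd).tendsto
    (u₀, v₀)).comp (hu.prodMk_nhds hv)

/-- The functional is continuous under bounded pointwise convergence. -/
theorem tendsto_smoothFunctional {h : ℝ} (hh : 0 < h) {V₀ R : Matrix (Fin n) (Fin n) ℝ}
    {N M₁ M₂ : ℝ → Matrix (Fin n) (Fin n) ℝ} (hN : Continuous N) (h₁ : Continuous M₁)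
    (h₂ : Continuous M₂) {ξ : ℕ → Fin n → ℝ} {ξ₀ : Fin n → ℝ} {φ : ℕ → ℝ → Fin n → ℝ}
    {φ₀ : ℝ → Fin n → ℝ} {B : ℝ} (hξ : Tendsto ξ atTop (𝓝 ξ₀)) (hξB : ∀ k, ‖ξ k‖ ≤ B)
    (hφc : ∀ k, Continuous (φ k)) (hφB : ∀ k, ∀ θ ∈ Icc (-h) 0, ‖φ k θ‖ ≤ B)
    (hφ : ∀ θ ∈ Ioo (-h) 0, Tendsto (fun k => φ k θ) atTop (𝓝 (φ₀ θ))) :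
    Tendsto (fun k => smoothFunctional h V₀ R N M₁ M₂ (ξ k) (φ k)) atTop
      (𝓝 (smoothFunctional h V₀ R N M₁ M₂ ξ₀ φ₀)) := by
  have hle : -h ≤ 0 := by linarith
  have hIoc : ∀ θ, θ ∈ uIoc (-h) 0 → θ ∈ Ioc (-h) 0 := fun θ hθ => by rwa [uIoc_of_le hle] at hθ
  -- Convergence is assumed only in the open interval: the approximations in
  -- `IsSmoothLyapunov.nonneg` may keep a wrong value at `0`, a null set.
  have hIoo : ∀ᵐ θ : ℝ, θ ∈ uIoc (-h) 0 → θ ∈ Ioo (-h) 0 := by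
    filter_upwards [volume.ae_ne (0 : ℝ)] with θ h0 hθ
    exact ⟨(hIoc θ hθ).1, lt_of_le_of_ne (hIoc θ hθ).2 h0⟩
  obtain ⟨CN, hCN⟩ := exists_bilin_bound hN B h
  obtain ⟨CR, hCR⟩ := exists_bilin_bound (continuous_const (y := R)) B h
  obtain ⟨C1, hC1⟩ := exists_bilin_bound h₁ B h
  obtain ⟨C2, hC2⟩ := exists_bilin_bound h₂ B h
  have c2 : Continuous fun p : ℝ × ℝ => p.1 - p.2 := by fun_prop
  have c3 : Continuous fun p : ℝ × ℝ => p.2 - p.1 := by fun_prop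
  have t1 : Tendsto (fun k => ∫ θ in (-h)..0, ξ k ⬝ᵥ N (h + θ) *ᵥ φ k θ) atTop
      (𝓝 (∫ θ in (-h)..0, ξ₀ ⬝ᵥ N (h + θ) *ᵥ φ₀ θ)) := by
    refine intervalIntegral.tendsto_integral_filter_of_dominated_convergence (fun _ => CN)
      (Eventually.of_forall fun k => ?_) (Eventually.of_forall fun k => ?_)
      intervalIntegrable_const ?_
    · exact (continuous_bilin continuous_const (hN.comp (continuous_const.add continuous_id))
        (hφc k)).aestronglyMeasurable
    · refine Eventually.of_forall fun θ hθ => hCN _ _ _ (hξB k)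
        (hφB k θ (Ioc_subset_Icc_self (hIoc θ hθ))) ?_
      have := hIoc θ hθ
      rw [abs_le]; constructor <;> linarith [this.1, this.2]
    · filter_upwards [hIoo] with θ hθ hθ'
      exact tendsto_bilin hξ (hφ θ (hθ hθ')) _
  have t2 : Tendsto (fun k => ∫ θ in (-h)..0, φ k θ ⬝ᵥ R *ᵥ φ k θ) atTop
      (𝓝 (∫ θ in (-h)..0, φ₀ θ ⬝ᵥ R *ᵥ φ₀ θ)) := by
    refine intervalIntegral.tendsto_integral_filter_of_dominated_convergence (fun _ => CR)
      (Eventually.of_forall fun k => ?_) (Eventually.of_forall fun k => ?_)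
      intervalIntegrable_const ?_
    · exact (continuous_bilin (hφc k) continuous_const (hφc k)).aestronglyMeasurable
    · exact Eventually.of_forall fun θ hθ => hCR _ _ 0
        (hφB k θ (Ioc_subset_Icc_self (hIoc θ hθ))) (hφB k θ (Ioc_subset_Icc_self (hIoc θ hθ)))
        (by simpa using hh.le)
    · filter_upwards [hIoo] with θ hθ hθ'
      exact tendsto_bilin (hφ θ (hθ hθ')) (hφ θ (hθ hθ')) _
  have hin : ∀ {M : ℝ → Matrix (Fin n) (Fin n) ℝ} {C : ℝ} {e : ℝ × ℝ → ℝ}, Continuous M →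
      Continuous e → (∀ s ∈ Icc (-h) 0, ∀ r ∈ Icc (-h) 0, |e (s, r)| ≤ h) →
      (∀ (u v : Fin n → ℝ) (r : ℝ), ‖u‖ ≤ B → ‖v‖ ≤ B → |r| ≤ h → ‖u ⬝ᵥ M r *ᵥ v‖ ≤ C) →
      ∀ s ∈ Ioo (-h) 0, ∀ a b, a ∈ Icc (-h) 0 → b ∈ Icc (-h) 0 → a ≤ b →
      Tendsto (fun k => ∫ r in a..b, φ k s ⬝ᵥ M (e (s, r)) *ᵥ φ k r) atTop
        (𝓝 (∫ r in a..b, φ₀ s ⬝ᵥ M (e (s, r)) *ᵥ φ₀ r)) ∧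
      ∀ k, ‖∫ r in a..b, φ k s ⬝ᵥ M (e (s, r)) *ᵥ φ k r‖ ≤ C * h := by
    intro M C e hM he hbd hC s hs a b ha hb hab
    have hs' := Ioo_subset_Icc_self hs
    have hr : ∀ r, r ∈ uIoc a b → r ∈ Ioc (-h) 0 := fun r hr => by
      rw [uIoc_of_le hab] at hr
      exact ⟨ha.1.trans_lt hr.1, hr.2.trans hb.2⟩
    have hbound : ∀ k, ∀ r ∈ uIoc a b, ‖φ k s ⬝ᵥ M (e (s, r)) *ᵥ φ k r‖ ≤ C := fun k r hr' =>
      hC _ _ _ (hφB k s hs') (hφB k r (Ioc_subset_Icc_self (hr r hr')))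
        (hbd s hs' r (Ioc_subset_Icc_self (hr r hr')))
    refine ⟨?_, fun k => ?_⟩
    · refine intervalIntegral.tendsto_integral_filter_of_dominated_convergence (fun _ => C)
        (Eventually.of_forall fun k => ?_) (Eventually.of_forall fun k => ?_)
        intervalIntegrable_const ?_
      · exact (continuous_bilin continuous_const
          (hM.comp (he.comp (Continuous.prodMk_right s))) (hφc k)).aestronglyMeasurable
      · exact Eventually.of_forall fun r hr' => hbound k r hr'
      · filter_upwards [volume.ae_ne (0 : ℝ)] with r h0 hr'
        exact tendsto_bilin (hφ s hs) (hφ r ⟨(hr r hr').1, lt_of_le_of_ne (hr r hr').2 h0⟩) _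
    · have hC0 : 0 ≤ C := (norm_nonneg _).trans
        (hC (φ k s) (φ k s) 0 (hφB k s hs') (hφB k s hs') (by simpa using hh.le))
      refine (intervalIntegral.norm_integral_le_of_norm_le_const (hbound k)).trans ?_
      rw [abs_of_nonneg (sub_nonneg.2 hab)]
      exact mul_le_mul_of_nonneg_left (by linarith [ha.1, hb.2]) hC0
  have l1 := hin h₁ c2 (fun s hs r hr => by
    rw [abs_le]; constructor <;> linarith [hs.1, hs.2, hr.1, hr.2]) hC1
  have l2 := hin h₂ c3 (fun s hs r hr => by
    rw [abs_le]; constructor <;> linarith [hs.1, hs.2, hr.1, hr.2]) hC2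
  have hm : -h ∈ Icc (-h) 0 := ⟨le_rfl, hle⟩
  have h0 : (0 : ℝ) ∈ Icc (-h) 0 := ⟨hle, le_rfl⟩
  have t3 : Tendsto (fun k => triInt (-h) 0 (fun a b => φ k a ⬝ᵥ M₁ (a - b) *ᵥ φ k b)
        (fun a b => φ k a ⬝ᵥ M₂ (b - a) *ᵥ φ k b)) atTop
      (𝓝 (triInt (-h) 0 (fun a b => φ₀ a ⬝ᵥ M₁ (a - b) *ᵥ φ₀ b)
        (fun a b => φ₀ a ⬝ᵥ M₂ (b - a) *ᵥ φ₀ b))) := by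
    refine intervalIntegral.tendsto_integral_filter_of_dominated_convergence
      (fun _ => C1 * h + C2 * h)
      (Eventually.of_forall fun k => ?_) (Eventually.of_forall fun k => ?_)
      intervalIntegrable_const ?_
    · exact ((continuous_integral_interval (k := fun a b => φ k a ⬝ᵥ M₁ (a - b) *ᵥ φ k b)
        (continuous_bilin ((hφc k).comp continuous_fst) (h₁.comp c2)
          ((hφc k).comp continuous_snd)) continuous_const continuous_id).add
        (continuous_integral_interval (k := fun a b => φ k a ⬝ᵥ M₂ (b - a) *ᵥ φ k b)
        (continuous_bilin ((hφc k).comp continuous_fst) (h₂.comp c3)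
          ((hφc k).comp continuous_snd)) continuous_id continuous_const)).aestronglyMeasurable
    · filter_upwards [hIoo] with s hs hs'
      have hs1 := hs hs'
      have hs2 := Ioo_subset_Icc_self hs1
      exact (norm_add_le _ _).trans (add_le_add ((l1 s hs1 (-h) s hm hs2 hs2.1).2 k)
        ((l2 s hs1 s 0 hs2 h0 hs2.2).2 k))
    · filter_upwards [hIoo] with s hs hs'
      have hs1 := hs hs'
      have hs2 := Ioo_subset_Icc_self hs1
      exact (l1 s hs1 (-h) s hm hs2 hs2.1).1.add (l2 s hs1 s 0 hs2 h0 hs2.2).1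
  exact (((tendsto_bilin hξ hξ V₀).add (t1.const_mul 2)).add t3).sub t2

end SmoothFunctional

/-! ### Dissipation along solutions and nonnegativity -/

section Dissipation

variable {n : ℕ}

theorem bilin_swap {m l : Type*} [Fintype m] [Fintype l] (M : Matrix m l ℝ) (u : m → ℝ)
    (v : l → ℝ) : u ⬝ᵥ M *ᵥ v = v ⬝ᵥ Mᵀ *ᵥ u := by
  rw [dotProduct_mulVec, dotProduct_comm, mulVec_transpose]

theorem bilin_left {m l k : Type*} [Fintype m] [Fintype l] [Fintype k] (A : Matrix m k ℝ)
    (M : Matrix m l ℝ) (u : k → ℝ) (v : l → ℝ) :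
    (A *ᵥ u) ⬝ᵥ M *ᵥ v = u ⬝ᵥ (Aᵀ * M) *ᵥ v := by
  rw [← mulVec_mulVec, dotProduct_mulVec u, vecMul_transpose]

variable (A₁ D : Matrix (Fin n) (Fin n) ℝ) (V V₁ V₂ : ℝ → Matrix (Fin n) (Fin n) ℝ)

/-- Kernel of the mixed term. -/
def kernelN (r : ℝ) : Matrix (Fin n) (Fin n) ℝ := (V r)ᵀ * A₁ - (V₁ r)ᵀ * D

/-- Kernel of the double integral below the diagonal. -/
def kernelLower (r : ℝ) : Matrix (Fin n) (Fin n) ℝ :=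
  A₁ᵀ * V r * A₁ + (2 : ℝ) • (A₁ᵀ * V₁ r * D) - Dᵀ * V₂ r * D

/-- Kernel of the double integral above the diagonal. -/
def kernelUpper (r : ℝ) : Matrix (Fin n) (Fin n) ℝ :=
  A₁ᵀ * (V r)ᵀ * A₁ - (2 : ℝ) • (A₁ᵀ * (V₁ r)ᵀ * D) - Dᵀ * (V₂ r)ᵀ * D

variable {A₁ D V V₁ V₂} {h : ℝ} {A₀ W P : Matrix (Fin n) (Fin n) ℝ}

theorem IsSmoothLyapunov.continuous_kernelN (hV : IsSmoothLyapunov h A₀ A₁ D W P V V₁ V₂) :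
    Continuous (kernelN A₁ D V V₁) :=
  (hV.continuous₀.matrix_transpose.matrix_mul continuous_const).sub
    (hV.continuous₁.matrix_transpose.matrix_mul continuous_const)

theorem IsSmoothLyapunov.mHasDeriv_kernelN (hV : IsSmoothLyapunov h A₀ A₁ D W P V V₁ V₂) (t : ℝ) :
    MHasDeriv (kernelN A₁ D V V₁) (kernelN A₁ D V₁ V₂ t) t :=
  ((hV.deriv₁ t).transpose.mul_const A₁).sub ((hV.deriv₂ t).transpose.mul_const D)

theorem IsSmoothLyapunov.continuous_kernelN' (hV : IsSmoothLyapunov h A₀ A₁ D W P V V₁ V₂) :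
    Continuous (kernelN A₁ D V₁ V₂) :=
  (hV.continuous₁.matrix_transpose.matrix_mul continuous_const).sub
    (hV.continuous₂.matrix_transpose.matrix_mul continuous_const)

theorem IsSmoothLyapunov.continuous_kernelLower (hV : IsSmoothLyapunov h A₀ A₁ D W P V V₁ V₂) :
    Continuous (kernelLower A₁ D V V₁ V₂) :=
  (((continuous_const.matrix_mul hV.continuous₀).matrix_mul continuous_const).add
    (((continuous_const.matrix_mul hV.continuous₁).matrix_mul continuous_const).const_smul (2 : ℝ))).sub
    ((continuous_const.matrix_mul hV.continuous₂).matrix_mul continuous_const)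

theorem IsSmoothLyapunov.continuous_kernelUpper (hV : IsSmoothLyapunov h A₀ A₁ D W P V V₁ V₂) :
    Continuous (kernelUpper A₁ D V V₁ V₂) :=
  (((continuous_const.matrix_mul hV.continuous₀.matrix_transpose).matrix_mul continuous_const).sub
    (((continuous_const.matrix_mul hV.continuous₁.matrix_transpose).matrix_mul
      continuous_const).const_smul (2 : ℝ))).sub
    ((continuous_const.matrix_mul hV.continuous₂.matrix_transpose).matrix_mul continuous_const)

/-- This is the coefficient of `y(t)` in the integrand of the derivative, once `x(t) = y(t) + D x(t
- h)` is inserted. The first- and second-order dynamic equations replace `V₁ᵀ` and `V₂ᵀ` at `θ` by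
values at `h - θ`. The kernels enter only as `kernelLower + kernelUpperᵀ`, which supplies the
missing symmetrisation of the term `2 A₁ᵀ U' D`. -/
theorem IsSmoothLyapunov.kernel_identity (hV : IsSmoothLyapunov h A₀ A₁ D W P V V₁ V₂) {θ : ℝ}
    (hθ : θ ∈ Icc 0 h) :
    (2 : ℝ) • (A₀ᵀ * kernelN A₁ D V V₁ θ) - (2 : ℝ) • kernelN A₁ D V₁ V₂ θ
      + kernelLower A₁ D V V₁ V₂ (h - θ) + (kernelUpper A₁ D V V₁ V₂ (h - θ))ᵀ = 0 := by
  have e1 : (V₁ θ)ᵀ = A₀ᵀ * (V θ)ᵀ + A₁ᵀ * V (h - θ) - Dᵀ * V₁ (h - θ) := by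
    rw [← hV.dynamic θ hθ, add_sub_cancel_right]
  have e2 : (V₂ θ)ᵀ = A₀ᵀ * (V₁ θ)ᵀ - A₁ᵀ * V₁ (h - θ) + Dᵀ * V₂ (h - θ) := by
    rw [← hV.dynamic' θ hθ, sub_add_cancel]
  have e3 : kernelN A₁ D V₁ V₂ θ = A₀ᵀ * kernelN A₁ D V V₁ θ + (A₁ᵀ * V (h - θ) * A₁
      - Dᵀ * V₁ (h - θ) * A₁ + A₁ᵀ * V₁ (h - θ) * D - Dᵀ * V₂ (h - θ) * D) := by
    unfold kernelN
    rw [e2]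
    nth_rewrite 1 [e1]
    noncomm_ring
  rw [e3]
  simp only [kernelLower, kernelUpper, transpose_sub, transpose_add, transpose_mul,
    transpose_transpose, two_smul]
  noncomm_ring

/-- This is the coefficient of `x(t - h)`. The previous identity removes everything evaluated at `h
- θ`; what remains holds by the definition of the kernels. -/
theorem IsSmoothLyapunov.kernel_identity' (hV : IsSmoothLyapunov h A₀ A₁ D W P V V₁ V₂) {θ : ℝ}
    (hθ : θ ∈ Icc 0 h) :
    (2 : ℝ) • ((Dᵀ * A₀ᵀ + A₁ᵀ) * kernelN A₁ D V V₁ θ)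
      + Dᵀ * (kernelLower A₁ D V V₁ V₂ (h - θ) + (kernelUpper A₁ D V V₁ V₂ (h - θ))ᵀ)
      - (kernelUpper A₁ D V V₁ V₂ θ + (kernelLower A₁ D V V₁ V₂ θ)ᵀ) = 0 := by
  have e1 : kernelLower A₁ D V V₁ V₂ (h - θ) + (kernelUpper A₁ D V V₁ V₂ (h - θ))ᵀ =
      (2 : ℝ) • kernelN A₁ D V₁ V₂ θ - (2 : ℝ) • (A₀ᵀ * kernelN A₁ D V V₁ θ) := by
    have := hV.kernel_identity hθ
    rw [← sub_eq_zero, ← this]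
    abel
  rw [e1]
  simp only [kernelN, kernelLower, kernelUpper, transpose_sub, transpose_add,
    transpose_mul, transpose_transpose, two_smul]
  noncomm_ring

theorem IsSmoothLyapunov.integrand_eq_zero (hV : IsSmoothLyapunov h A₀ A₁ D W P V V₁ V₂)
    {θ : ℝ} (hθ : θ ∈ Icc 0 h) (z p u : Fin n → ℝ) :
    2 * ((A₀ *ᵥ (z + D *ᵥ p) + A₁ *ᵥ p) ⬝ᵥ kernelN A₁ D V V₁ θ *ᵥ u
        - z ⬝ᵥ kernelN A₁ D V₁ V₂ θ *ᵥ u)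
      + ((z + D *ᵥ p) ⬝ᵥ kernelLower A₁ D V V₁ V₂ (h - θ) *ᵥ u
        - p ⬝ᵥ kernelUpper A₁ D V V₁ V₂ θ *ᵥ u)
      + (u ⬝ᵥ kernelUpper A₁ D V V₁ V₂ (h - θ) *ᵥ (z + D *ᵥ p)
        - u ⬝ᵥ kernelLower A₁ D V V₁ V₂ θ *ᵥ p) = 0 := by
  have h1 := congrArg (fun M => z ⬝ᵥ M *ᵥ u) (hV.kernel_identity hθ)
  have h2 := congrArg (fun M => p ⬝ᵥ M *ᵥ u) (hV.kernel_identity' hθ)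
  rw [bilin_swap _ u (z + D *ᵥ p), bilin_swap _ u p]
  generalize kernelN A₁ D V V₁ θ = N at *
  generalize kernelN A₁ D V₁ V₂ θ = N' at *
  generalize kernelLower A₁ D V V₁ V₂ (h - θ) = L at *
  generalize (kernelUpper A₁ D V V₁ V₂ (h - θ))ᵀ = K at *
  generalize kernelUpper A₁ D V V₁ V₂ θ = K' at *
  generalize (kernelLower A₁ D V V₁ V₂ θ)ᵀ = L' at *
  simp only [add_mulVec, sub_mulVec, smul_mulVec, dotProduct_add, dotProduct_sub, dotProduct_smul,
    smul_eq_mul, zero_mulVec, dotProduct_zero, Matrix.add_mul, Matrix.mul_add] at h1 h2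
  simp only [add_dotProduct, mulVec_add, mulVec_mulVec, bilin_left, transpose_mul]
  linear_combination h1 + h2

/-- Here `z` and `p` stand for `y(t)` and `x(t - h)`. The dynamic equation at `θ = 0` turns the
mixed kernel at `h` into `V₁(0) - V(0) A₀`, so all terms with `V(0)` cancel. The others combine
through `P = V₁(0) + V₁(0)ᵀ` into `xᵀ (P - Dᵀ P D) x` with `x = z + D p`. -/
theorem IsSmoothLyapunov.boundary_identity (hV : IsSmoothLyapunov h A₀ A₁ D W P V V₁ V₂)
    (hh : 0 ≤ h) (z p : Fin n → ℝ) :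
    (A₀ *ᵥ (z + D *ᵥ p) + A₁ *ᵥ p) ⬝ᵥ V 0 *ᵥ z + z ⬝ᵥ V 0 *ᵥ (A₀ *ᵥ (z + D *ᵥ p) + A₁ *ᵥ p)
      + 2 * (z ⬝ᵥ kernelN A₁ D V V₁ h *ᵥ (z + D *ᵥ p) - z ⬝ᵥ kernelN A₁ D V V₁ 0 *ᵥ p)
      - ((z + D *ᵥ p) ⬝ᵥ (Dᵀ * P * D) *ᵥ (z + D *ᵥ p) - p ⬝ᵥ (Dᵀ * P * D) *ᵥ p)
      = -((z + D *ᵥ p) ⬝ᵥ W *ᵥ (z + D *ᵥ p)) := by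
  have hN : kernelN A₁ D V V₁ h = V₁ 0 - V 0 * A₀ := by
    have h1 := congrArg Matrix.transpose (hV.dynamic 0 ⟨le_rfl, hh⟩)
    simp only [sub_zero, transpose_add, transpose_mul, transpose_transpose] at h1
    have h2 : V₁ 0 = V 0 * A₀ + (V h)ᵀ * A₁ - (V₁ h)ᵀ * D := by
      rw [← h1, add_sub_cancel_right]
    unfold kernelN
    rw [h2]
    abel
  have hN0 : kernelN A₁ D V V₁ 0 = V 0 * A₁ - (V₁ 0)ᵀ * D := by
    unfold kernelN
    rw [hV.symm_zero]
  have hW : W = Dᵀ * P * D - P := by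
    rw [← neg_neg W, ← hV.algebraic, neg_sub]
  have hpp : p ⬝ᵥ (Dᵀ * P * D) *ᵥ p = (D *ᵥ p) ⬝ᵥ P *ᵥ (D *ᵥ p) := by
    rw [bilin_left, mulVec_mulVec]
  have hQ : ∀ u v : Fin n → ℝ, u ⬝ᵥ P *ᵥ v = u ⬝ᵥ V₁ 0 *ᵥ v + v ⬝ᵥ V₁ 0 *ᵥ u := by
    intro u v
    rw [← hV.jump, add_mulVec, dotProduct_add, ← bilin_swap]
  have hQt : ∀ u v : Fin n → ℝ, u ⬝ᵥ (V₁ 0)ᵀ *ᵥ v = v ⬝ᵥ V₁ 0 *ᵥ u :=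
    fun u v => (bilin_swap _ _ _).symm
  have hV0 := bilin_swap (V 0) (A₀ *ᵥ (z + D *ᵥ p) + A₁ *ᵥ p) z
  rw [hV.symm_zero] at hV0
  rw [hN, hN0, hpp, hV0, hW]
  simp only [sub_mulVec, dotProduct_sub, ← mulVec_mulVec _ (V 0), ← mulVec_mulVec _ (V₁ 0)ᵀ,
    hQ (D *ᵥ p), hQ (z + D *ᵥ p), hQt]
  generalize D *ᵥ p = b
  simp only [mulVec_add, dotProduct_add, add_dotProduct]
  ring

/-- Along solutions the functional decreases at the rate `x(t)ᵀ W x(t)`. -/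
theorem IsSmoothLyapunov.hasDerivAt_functional (hV : IsSmoothLyapunov h A₀ A₁ D W P V V₁ V₂)
    (hh : 0 ≤ h) {x y : ℝ → Fin n → ℝ} (hx : Continuous x)
    (hy : ∀ t, HasDerivAt y (A₀ *ᵥ (y t + D *ᵥ x (t - h)) + A₁ *ᵥ x (t - h)) t) {t : ℝ}
    (hxy : x t = y t + D *ᵥ x (t - h)) :
    HasDerivAt (fun t => smoothFunctional h (V 0) (Dᵀ * P * D) (kernelN A₁ D V V₁)
        (kernelLower A₁ D V V₁ V₂) (kernelUpper A₁ D V V₁ V₂) (y t) (fun θ => x (t + θ)))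
      (-(x t ⬝ᵥ W *ᵥ x t)) t := by
  have hyc : Continuous y := continuous_iff_continuousAt.2 fun t => (hy t).continuousAt
  have hxs : Continuous fun t => x (t - h) := hx.comp (continuous_id.sub continuous_const)
  refine (hasDerivAt_smoothFunctional hV.mHasDeriv_kernelN hV.continuous_kernelN'
    hV.continuous_kernelLower hV.continuous_kernelUpper hx hy
    ((continuous_mulVec_comp _ (hyc.add (continuous_mulVec_comp _ hxs))).add
      (continuous_mulVec_comp _ hxs)) t).congr_deriv ?_
  have hzero : ∀ s ∈ uIcc (t - h) t, s - (t - h) ∈ Icc 0 h := fun s hs => by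
    rw [uIcc_of_le (by linarith)] at hs
    exact ⟨by linarith [hs.1], by linarith [hs.2]⟩
  rw [hxy, hV.boundary_identity hh, intervalIntegral.integral_congr (g := fun _ => 0)]
  · simp
  · intro s hs
    have := hV.integrand_eq_zero (hzero s hs) (y t) (x (t - h)) (x s)
    rw [show h - (s - (t - h)) = t - s by ring] at this
    exact this

/-- The functional is nonnegative at initial functions of class `C¹`. -/
theorem IsSmoothLyapunov.exists_nonneg (hV : IsSmoothLyapunov h A₀ A₁ D W P V V₁ V₂)
    (hh : 0 < h) (hW : W.PosDef) (hs : ExpStable h A₀ A₁ D) {φ : ℝ → Fin n → ℝ}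
    (hφ : ContDiff ℝ 1 φ) :
    ∃ x : ℝ → Fin n → ℝ, Continuous x ∧ (∀ t ≤ 0, x t = φ t) ∧
      0 ≤ smoothFunctional h (V 0) (Dᵀ * P * D) (kernelN A₁ D V V₁)
        (kernelLower A₁ D V V₁ V₂) (kernelUpper A₁ D V V₁ V₂) (φ 0 - D *ᵥ φ (-h)) x := by
  obtain ⟨x, y, hx, hx0, hy, hxy⟩ := exists_continuous_solution hh A₀ A₁ D hφ.continuous
  obtain ⟨γ, hγ, σ, hσ, H⟩ := hs.exists_norm_bound hh
  obtain ⟨B, hB⟩ := isCompact_Icc.exists_bound_of_continuousOn (s := Icc (-h) 0)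
    hφ.continuous.continuousOn
  have hB0 : 0 ≤ B := (norm_nonneg _).trans (hB 0 ⟨by linarith, le_rfl⟩)
  have hdec := H φ hφ x (isSolution_of_pair hx hx0 hy hxy) B hB
  have hxB : ∀ t, -h ≤ t → ‖x t‖ ≤ (γ + 1) * B := by
    intro t ht
    rcases le_total t 0 with h0 | h0
    · rw [hx0 t h0]
      exact (hB t ⟨ht, h0⟩).trans (by nlinarith)
    · have h2 : Real.exp (-σ * t) ≤ 1 := Real.exp_le_one_iff.2 (by nlinarith)
      calc ‖x t‖ ≤ γ * Real.exp (-σ * t) * B := hdec t h0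
        _ ≤ γ * 1 * B := by gcongr
        _ ≤ _ := by nlinarith
  have hxlim : Tendsto x atTop (𝓝 0) := by
    refine squeeze_zero_norm' (a := fun t => γ * Real.exp (-σ * t) * B) ?_ ?_
    · filter_upwards [eventually_ge_atTop 0] with t ht using hdec t ht
    · have h1 : Tendsto (fun t : ℝ => -σ * t) atTop atBot :=
        tendsto_id.const_mul_atTop_of_neg (neg_lt_zero.2 hσ)
      simpa using ((Real.tendsto_exp_atBot.comp h1).const_mul γ).mul_const B
  have hyx : ∀ t, 0 ≤ t → y t = x t - D *ᵥ x (t - h) := fun t ht => by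
    rw [hxy t ht, add_sub_cancel_right]
  set F : ℝ → ℝ := fun t => smoothFunctional h (V 0) (Dᵀ * P * D) (kernelN A₁ D V V₁)
    (kernelLower A₁ D V V₁ V₂) (kernelUpper A₁ D V V₁ V₂) (y t) (fun θ => x (t + θ)) with hF
  have hFd : ∀ t, 0 ≤ t → HasDerivAt F (-(x t ⬝ᵥ W *ᵥ x t)) t := fun t ht =>
    hV.hasDerivAt_functional hh.le hx hy (hxy t ht)
  have hanti : AntitoneOn F (Ici 0) := by
    refine antitoneOn_of_deriv_nonpos (convex_Ici 0)
      (fun t ht => (hFd t ht).continuousAt.continuousWithinAt) ?_ ?_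
    · intro t ht
      rw [interior_Ici] at ht
      exact (hFd t (le_of_lt ht)).differentiableAt.differentiableWithinAt
    · intro t ht
      rw [interior_Ici] at ht
      rw [(hFd t (le_of_lt ht)).deriv]
      simpa using hW.posSemidef.dotProduct_mulVec_nonneg (x t)
  -- Integer times suffice, as `F` is monotone. The shifted solutions are uniformly bounded and
  -- converge pointwise to `0`, as does `y`.
  have hlim : Tendsto (fun k : ℕ => F k) atTop (𝓝 0) := by
    have h1 := tendsto_smoothFunctional hh (V₀ := V 0) (R := Dᵀ * P * D) hV.continuous_kernelN
      hV.continuous_kernelLower hV.continuous_kernelUpper (ξ := fun k => y k) (ξ₀ := 0)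
      (φ := fun k θ => x (k + θ)) (φ₀ := 0)
      (B := (γ + 1) * B + ‖mulVecCLM D‖ * ((γ + 1) * B)) ?_ ?_ ?_ ?_ ?_
    · have h2 : smoothFunctional h (V 0) (Dᵀ * P * D) (kernelN A₁ D V V₁)
          (kernelLower A₁ D V V₁ V₂) (kernelUpper A₁ D V V₁ V₂) 0 0 = 0 := by
        simp [smoothFunctional, triInt]
      rwa [h2] at h1
    · have h2 : Tendsto (fun t : ℝ => x t - mulVecCLM D (x (t - h))) atTop
          (𝓝 (0 - mulVecCLM D 0)) :=
        hxlim.sub (((mulVecCLM D).continuous.tendsto 0).comp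
          (hxlim.comp (tendsto_atTop_add_const_right _ (-h) tendsto_id)))
      rw [map_zero, sub_zero] at h2
      refine (h2.comp tendsto_natCast_atTop_atTop).congr fun k => ?_
      exact (hyx k (Nat.cast_nonneg k)).symm
    · intro k
      have hk : (0 : ℝ) ≤ k := Nat.cast_nonneg k
      rw [hyx k hk]
      refine (norm_sub_le _ _).trans (add_le_add (hxB _ (by linarith)) ?_)
      exact ((mulVecCLM D).le_opNorm _).trans
        (mul_le_mul_of_nonneg_left (hxB _ (by linarith)) (norm_nonneg _))
    · exact fun k => hx.comp (continuous_const.add continuous_id)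
    · intro k θ hθ
      have hk : (0 : ℝ) ≤ k := Nat.cast_nonneg k
      have := hxB (k + θ) (by linarith [hθ.1])
      have h3 : 0 ≤ ‖mulVecCLM D‖ * ((γ + 1) * B) := by positivity
      linarith
    · intro θ _
      exact hxlim.comp (tendsto_atTop_add_const_right _ θ tendsto_natCast_atTop_atTop)
  have hF0 : 0 ≤ F 0 := le_of_tendsto' hlim fun k =>
    hanti self_mem_Ici (mem_Ici.2 (Nat.cast_nonneg k)) (Nat.cast_nonneg k)
  refine ⟨x, hx, hx0, ?_⟩
  have hy0 : y 0 = φ 0 - D *ᵥ φ (-h) := by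
    rw [hyx 0 le_rfl, hx0 0 le_rfl, zero_sub, hx0 (-h) (by linarith)]
  simpa [hF, hy0] using hF0

/-- The functional is nonnegative for an arbitrary vector and a `C¹` function. -/
theorem IsSmoothLyapunov.nonneg (hV : IsSmoothLyapunov h A₀ A₁ D W P V V₁ V₂)
    (hh : 0 < h) (hW : W.PosDef) (hs : ExpStable h A₀ A₁ D) (ξ : Fin n → ℝ) {φ : ℝ → Fin n → ℝ}
    (hφ : ContDiff ℝ 1 φ) :
    0 ≤ smoothFunctional h (V 0) (Dᵀ * P * D) (kernelN A₁ D V V₁)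
        (kernelLower A₁ D V V₁ V₂) (kernelUpper A₁ D V V₁ V₂) ξ φ := by
  -- Adding `a` at `0` and nothing at `-h` makes the difference `ψ(0) - D ψ(-h)` equal to `ξ`. The
  -- profile `(1 + θ/h)^(m+1)` does this and tends to `0` for `-h ≤ θ < 0`; the exponent `m + 1`
  -- makes it vanish at `-h` already for `m = 0`.
  set a : Fin n → ℝ := ξ + D *ᵥ φ (-h) - φ 0 with ha
  set ψ : ℕ → ℝ → Fin n → ℝ := fun m θ => φ θ + (1 + θ / h) ^ (m + 1) • a with hψ
  have hψc : ∀ m, ContDiff ℝ 1 (ψ m) := fun m => by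
    have : ContDiff ℝ 1 fun θ : ℝ => (1 + θ / h) ^ (m + 1) := by fun_prop
    exact hφ.add (this.smul contDiff_const)
  have hψ0 : ∀ m, ψ m 0 - D *ᵥ ψ m (-h) = ξ := fun m => by
    have : 1 + -h / h = 0 := by field_simp; ring
    simp [hψ, this, ha]
  choose x hx hx0 hpos using fun m => hV.exists_nonneg hh hW hs (hψc m)
  obtain ⟨B, hB⟩ := isCompact_Icc.exists_bound_of_continuousOn (s := Icc (-h) 0)
    hφ.continuous.continuousOn
  have hunit : ∀ θ ∈ Icc (-h) 0, 0 ≤ 1 + θ / h ∧ 1 + θ / h ≤ 1 := fun θ hθ => by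
    constructor
    · have : -1 ≤ θ / h := by rw [le_div_iff₀ hh]; linarith [hθ.1]
      linarith
    · have : θ / h ≤ 0 := div_nonpos_of_nonpos_of_nonneg hθ.2 hh.le
      linarith
  refine ge_of_tendsto' (tendsto_smoothFunctional hh hV.continuous_kernelN
    hV.continuous_kernelLower hV.continuous_kernelUpper (ξ := fun _ => ξ) (φ := x)
    (B := max ‖ξ‖ (B + ‖a‖)) tendsto_const_nhds (fun _ => le_max_left _ _) hx ?_ ?_) fun m => ?_
  · intro m θ hθ
    rw [hx0 m θ hθ.2]
    refine le_trans ?_ (le_max_right _ _)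
    refine (norm_add_le _ _).trans (add_le_add (hB θ hθ) ?_)
    obtain ⟨h0, h1⟩ := hunit θ hθ
    rw [norm_smul, Real.norm_of_nonneg (pow_nonneg h0 _)]
    exact mul_le_of_le_one_left (norm_nonneg _) (pow_le_one₀ h0 h1)
  · intro θ hθ
    obtain ⟨h0, _⟩ := hunit θ (Ioo_subset_Icc_self hθ)
    have h1 : 1 + θ / h < 1 := by
      have : θ / h < 0 := div_neg_of_neg_of_pos hθ.2 hh
      linarith
    have h2 : Tendsto (fun m => ψ m θ) atTop (𝓝 (φ θ + (0 : ℝ) • a)) :=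
      (((tendsto_pow_atTop_nhds_zero_of_lt_one h0 h1).comp (tendsto_add_atTop_nat 1)).smul_const
        a).const_add _
    rw [zero_smul, add_zero] at h2
    exact h2.congr fun m => (hx0 m θ hθ.2.le).symm
  · have := hpos m
    rwa [hψ0] at this

end Dissipation

/-! ### Integrals of kernels that jump across the diagonal -/

section TriangularIntegrals

theorem integral_dotProduct_left {n : ℕ} (ξ : Fin n → ℝ) {f : ℝ → Fin n → ℝ} {a b : ℝ}
    (hf : IntervalIntegrable f volume a b) :
    ξ ⬝ᵥ ∫ θ in a..b, f θ = ∫ θ in a..b, ξ ⬝ᵥ f θ := by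
  let L : (Fin n → ℝ) →L[ℝ] ℝ := ∑ i, ξ i • ContinuousLinearMap.proj (R := ℝ) i
  have hL : ∀ v, L v = ξ ⬝ᵥ v := fun v => by simp [L, dotProduct]
  simpa only [hL] using (L.intervalIntegral_comp_comm hf).symm

variable {h : ℝ} {g k₁ k₂ : ℝ → ℝ → ℝ}

/-- The kernel `g` is `k₁` below and `k₂` above the diagonal of the open square `(-h, 0)²`. -/
structure IsSplitKernel (h : ℝ) (g k₁ k₂ : ℝ → ℝ → ℝ) : Prop where
  lower : ∀ a ∈ Ioo (-h) 0, ∀ b ∈ Ioo (-h) 0, b < a → g a b = k₁ a b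
  upper : ∀ a ∈ Ioo (-h) 0, ∀ b ∈ Ioo (-h) 0, a < b → g a b = k₂ a b
  continuous_lower : Continuous (Function.uncurry k₁)
  continuous_upper : Continuous (Function.uncurry k₂)

theorem IsSplitKernel.eqOn_lower (hg : IsSplitKernel h g k₁ k₂) {a : ℝ} (ha : a ∈ Ioo (-h) 0) :
    EqOn (g a) (k₁ a) (Ioo (-h) a) :=
  fun _ hb => hg.lower a ha _ ⟨hb.1, hb.2.trans ha.2⟩ hb.2

theorem IsSplitKernel.eqOn_upper (hg : IsSplitKernel h g k₁ k₂) {a : ℝ} (ha : a ∈ Ioo (-h) 0) :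
    EqOn (g a) (k₂ a) (Ioo a 0) :=
  fun _ hb => hg.upper a ha _ ⟨ha.1.trans hb.1, hb.2⟩ hb.1

theorem IsSplitKernel.integral_lower (hg : IsSplitKernel h g k₁ k₂) {a : ℝ}
    (ha : a ∈ Ioo (-h) 0) : ∫ b in (-h)..a, g a b = ∫ b in (-h)..a, k₁ a b :=
  intervalIntegral.integral_congr_Ioo_of_le ha.1.le (hg.eqOn_lower ha)

theorem IsSplitKernel.integral_upper (hg : IsSplitKernel h g k₁ k₂) {a : ℝ}
    (ha : a ∈ Ioo (-h) 0) : ∫ b in a..0, g a b = ∫ b in a..0, k₂ a b :=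
  intervalIntegral.integral_congr_Ioo_of_le ha.2.le (hg.eqOn_upper ha)

theorem IsSplitKernel.integral_add_eq (hg : IsSplitKernel h g k₁ k₂) (hh : 0 < h) :
    ∫ a in (-h)..0, ((∫ b in (-h)..a, g a b) + ∫ b in a..0, g a b) = triInt (-h) 0 k₁ k₂ :=
  intervalIntegral.integral_congr_Ioo_of_le (by linarith) fun a ha => by
    simp only [hg.integral_lower ha, hg.integral_upper ha]

/-- The values of `g` on the diagonal, where `U'` may jump and `U''` need not exist, do not affect
the inner integrals. Integrability on each side is inherited from `k₁` and `k₂`. -/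
theorem IsSplitKernel.integral_square_eq (hg : IsSplitKernel h g k₁ k₂) (hh : 0 < h) :
    ∫ a in (-h)..0, ∫ b in (-h)..0, g a b = triInt (-h) 0 k₁ k₂ := by
  rw [← hg.integral_add_eq hh]
  refine intervalIntegral.integral_congr_Ioo_of_le (by linarith) fun a ha => ?_
  have c1 : Continuous (k₁ a) := hg.continuous_lower.comp (Continuous.prodMk_right a)
  have c2 : Continuous (k₂ a) := hg.continuous_upper.comp (Continuous.prodMk_right a)
  refine (intervalIntegral.integral_add_adjacent_intervals ?_ ?_).symm
  · refine (c1.intervalIntegrable _ _).congr_uIoo ?_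
    rw [uIoo_of_le ha.1.le]
    exact (hg.eqOn_lower ha).symm
  · refine (c2.intervalIntegrable _ _).congr_uIoo ?_
    rw [uIoo_of_le ha.2.le]
    exact (hg.eqOn_upper ha).symm

theorem intervalIntegrable_lower (hk : Continuous (Function.uncurry k₁)) (a c : ℝ) :
    IntervalIntegrable (fun s => ∫ r in a..s, k₁ s r) volume a c :=
  (continuous_integral_interval hk continuous_const continuous_id).intervalIntegrable _ _

theorem intervalIntegrable_upper (hk : Continuous (Function.uncurry k₂)) (a c : ℝ) :
    IntervalIntegrable (fun s => ∫ r in s..c, k₂ s r) volume a c :=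
  (continuous_integral_interval hk continuous_id continuous_const).intervalIntegrable _ _

theorem IsSplitKernel.integral_add_integral_eq (hg : IsSplitKernel h g k₁ k₂) (hh : 0 < h) :
    (∫ a in (-h)..0, ∫ b in (-h)..a, g a b) + ∫ a in (-h)..0, ∫ b in a..0, g a b =
      triInt (-h) 0 k₁ k₂ := by
  have hle : -h ≤ 0 := by linarith
  rw [intervalIntegral.integral_congr_Ioo_of_le hle fun a ha => hg.integral_lower ha,
    intervalIntegral.integral_congr_Ioo_of_le hle fun a ha => hg.integral_upper ha,
    ← intervalIntegral.integral_add (intervalIntegrable_lower hg.continuous_lower _ _)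
      (intervalIntegrable_upper hg.continuous_upper _ _)]
  rfl

theorem triInt_add {l₁ l₂ : ℝ → ℝ → ℝ} (h₁ : Continuous (Function.uncurry k₁))
    (h₂ : Continuous (Function.uncurry k₂)) (h₁' : Continuous (Function.uncurry l₁))
    (h₂' : Continuous (Function.uncurry l₂)) (a c : ℝ) :
    triInt a c k₁ k₂ + triInt a c l₁ l₂ =
      triInt a c (fun s r => k₁ s r + l₁ s r) (fun s r => k₂ s r + l₂ s r) := by
  have e : ∀ {k : ℝ → ℝ → ℝ}, Continuous (Function.uncurry k) → ∀ s u v,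
      IntervalIntegrable (k s) volume u v := fun hk s u v =>
    (hk.comp (Continuous.prodMk_right s)).intervalIntegrable _ _
  unfold triInt
  rw [← intervalIntegral.integral_add
    ((intervalIntegrable_lower h₁ _ _).add (intervalIntegrable_upper h₂ _ _))
    ((intervalIntegrable_lower h₁' _ _).add (intervalIntegrable_upper h₂' _ _))]
  refine intervalIntegral.integral_congr fun s _ => ?_
  simp only
  rw [intervalIntegral.integral_add (e h₁ _ _ _) (e h₁' _ _ _),
    intervalIntegral.integral_add (e h₂ _ _ _) (e h₂' _ _ _)]
  ring

theorem triInt_const_mul (c' a c : ℝ) (k₁ k₂ : ℝ → ℝ → ℝ) :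
    c' * triInt a c k₁ k₂ = triInt a c (fun s r => c' * k₁ s r) (fun s r => c' * k₂ s r) := by
  unfold triInt
  simp only [intervalIntegral.integral_const_mul, ← mul_add]

theorem triInt_combination {l₁ l₂ m₁ m₂ : ℝ → ℝ → ℝ} (hk₁ : Continuous (Function.uncurry k₁))
    (hk₂ : Continuous (Function.uncurry k₂)) (hl₁ : Continuous (Function.uncurry l₁))
    (hl₂ : Continuous (Function.uncurry l₂)) (hm₁ : Continuous (Function.uncurry m₁))
    (hm₂ : Continuous (Function.uncurry m₂)) (a c : ℝ) :
    triInt a c k₁ k₂ + 2 * triInt a c l₁ l₂ - triInt a c m₁ m₂ =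
      triInt a c (fun s r => k₁ s r + 2 * l₁ s r - m₁ s r)
        (fun s r => k₂ s r + 2 * l₂ s r - m₂ s r) := by
  have hc : ∀ {k : ℝ → ℝ → ℝ} (b : ℝ), Continuous (Function.uncurry k) →
      Continuous (Function.uncurry fun s r => b * k s r) := fun b hk => continuous_const.mul hk
  have ha : ∀ {k l : ℝ → ℝ → ℝ}, Continuous (Function.uncurry k) → Continuous (Function.uncurry l) →
      Continuous (Function.uncurry fun s r => k s r + l s r) := fun hk hl => hk.add hl
  rw [sub_eq_add_neg, ← neg_one_mul (triInt a c m₁ m₂), triInt_const_mul, triInt_const_mul,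
    triInt_add hk₁ hk₂ (hc 2 hl₁) (hc 2 hl₂),
    triInt_add (ha hk₁ (hc 2 hl₁)) (ha hk₂ (hc 2 hl₂)) (hc (-1) hm₁) (hc (-1) hm₂)]
  simp only [neg_one_mul, ← sub_eq_add_neg]

theorem triInt_sum {ι : Type*} (S : Finset ι) {k₁ k₂ : ι → ℝ → ℝ → ℝ}
    (h₁ : ∀ i, Continuous (Function.uncurry (k₁ i)))
    (h₂ : ∀ i, Continuous (Function.uncurry (k₂ i))) (a c : ℝ) :
    ∑ i ∈ S, triInt a c (k₁ i) (k₂ i) =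
      triInt a c (fun s r => ∑ i ∈ S, k₁ i s r) (fun s r => ∑ i ∈ S, k₂ i s r) := by
  classical
  have hc : ∀ {k : ι → ℝ → ℝ → ℝ}, (∀ i, Continuous (Function.uncurry (k i))) →
      ∀ S : Finset ι, Continuous (Function.uncurry fun s r => ∑ i ∈ S, k i s r) :=
    fun hk S => continuous_finsetSum S fun i _ => hk i
  induction S using Finset.induction_on with
  | empty => simp [triInt]
  | insert i S hi ih =>
    rw [Finset.sum_insert hi, ih, triInt_add (h₁ i) (h₂ i) (hc h₁ S) (hc h₂ S)]
    simp only [Finset.sum_insert hi]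

theorem dotProduct_mulVec_eq_sum {m l : Type*} [Fintype m] [Fintype l] (M : Matrix m l ℝ)
    (u : m → ℝ) (v : l → ℝ) : u ⬝ᵥ M *ᵥ v = ∑ q : m × l, u q.1 * v q.2 * M q.1 q.2 := by
  rw [Fintype.sum_prod_type]
  simp only [dotProduct, mulVec, Finset.mul_sum]
  exact Finset.sum_congr rfl fun i _ => Finset.sum_congr rfl fun j _ => by ring

theorem dotProduct_integral_mulVec {m l : Type*} [Fintype m] [Fintype l] {M : ℝ → Matrix m l ℝ}
    (hM : Continuous M) (u : m → ℝ) (v : l → ℝ) (a b : ℝ) :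
    u ⬝ᵥ (Matrix.of fun i j => ∫ θ in a..b, M θ i j) *ᵥ v = ∫ θ in a..b, u ⬝ᵥ M θ *ᵥ v := by
  simp only [dotProduct_mulVec_eq_sum]
  have h2 := intervalIntegral.integral_finsetSum (μ := volume) (a := a) (b := b)
    (s := (Finset.univ : Finset (m × l))) (f := fun q θ => u q.1 * v q.2 * M θ q.1 q.2)
    fun q _ => Continuous.intervalIntegrable (continuous_const.mul (hM.matrix_elem q.1 q.2)) _ _
  refine Eq.trans ?_ h2.symm
  exact Finset.sum_congr rfl fun q _ => (intervalIntegral.integral_const_mul _ _).symm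

theorem dotProduct_triInt_mulVec {m l : Type*} [Fintype m] [Fintype l]
    {K₁ K₂ : ℝ → ℝ → Matrix m l ℝ} (h₁ : Continuous (Function.uncurry K₁))
    (h₂ : Continuous (Function.uncurry K₂)) (u : m → ℝ) (v : l → ℝ) (a c : ℝ) :
    u ⬝ᵥ (Matrix.of fun i j => triInt a c (fun s r => K₁ s r i j) fun s r => K₂ s r i j) *ᵥ v =
      triInt a c (fun s r => u ⬝ᵥ K₁ s r *ᵥ v) (fun s r => u ⬝ᵥ K₂ s r *ᵥ v) := by
  have hc : ∀ {K : ℝ → ℝ → Matrix m l ℝ}, Continuous (Function.uncurry K) → ∀ i j,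
      Continuous (Function.uncurry fun s r => u i * v j * K s r i j) :=
    fun hK i j => continuous_const.mul (hK.matrix_elem i j)
  simp only [dotProduct_mulVec_eq_sum]
  have h2 := triInt_sum (Finset.univ : Finset (m × l))
    (k₁ := fun q s r => u q.1 * v q.2 * K₁ s r q.1 q.2)
    (k₂ := fun q s r => u q.1 * v q.2 * K₂ s r q.1 q.2) (fun q => hc h₁ q.1 q.2)
    (fun q => hc h₂ q.1 q.2) a c
  refine Eq.trans ?_ h2
  exact Finset.sum_congr rfl fun q _ => triInt_const_mul _ _ _ _ _

end TriangularIntegrals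

/-! ### The matrix of the quadratic form -/

section QuadraticForm

variable {n N : ℕ} {h : ℝ} {A₀ A₁ D W P : Matrix (Fin n) (Fin n) ℝ}
  {U V V₁ V₂ : ℝ → Matrix (Fin n) (Fin n) ℝ}

/-- The Lyapunov-Krasovskii functional in terms of the smooth matrix function `V`. -/
def expandedFunctional (h : ℝ) (A₁ D P : Matrix (Fin n) (Fin n) ℝ)
    (V V₁ V₂ : ℝ → Matrix (Fin n) (Fin n) ℝ) (ξ : Fin n → ℝ) (φ : ℝ → Fin n → ℝ) : ℝ :=
  ξ ⬝ᵥ V 0 *ᵥ ξ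
  + 2 * (∫ θ in (-h)..0, ξ ⬝ᵥ ((V (h + θ))ᵀ * A₁) *ᵥ φ θ)
  - 2 * (∫ θ in (-h)..0, ξ ⬝ᵥ ((V₁ (h + θ))ᵀ * D) *ᵥ φ θ)
  + triInt (-h) 0 (fun a b => φ a ⬝ᵥ (A₁ᵀ * V (a - b) * A₁) *ᵥ φ b)
      (fun a b => φ a ⬝ᵥ (A₁ᵀ * (V (b - a))ᵀ * A₁) *ᵥ φ b)
  + 2 * triInt (-h) 0 (fun a b => φ a ⬝ᵥ (A₁ᵀ * V₁ (a - b) * D) *ᵥ φ b)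
      (fun a b => φ a ⬝ᵥ (A₁ᵀ * -(V₁ (b - a))ᵀ * D) *ᵥ φ b)
  - triInt (-h) 0 (fun a b => φ a ⬝ᵥ (Dᵀ * V₂ (a - b) * D) *ᵥ φ b)
      (fun a b => φ a ⬝ᵥ (Dᵀ * (V₂ (b - a))ᵀ * D) *ᵥ φ b)
  - ∫ θ in (-h)..0, φ θ ⬝ᵥ (Dᵀ * P * D) *ᵥ φ θ

/-- The function `F` is left general so that the same statement serves the bilinear forms in the
functional and the entries of the matrices `J₃`, `J₄`, `J₅`. -/
theorem isSplitKernel_of_matrix {K L₁ L₂ : ℝ → Matrix (Fin n) (Fin n) ℝ}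
    (hpos : ∀ r ∈ Ioo 0 h, K r = L₁ r) (hneg : ∀ r ∈ Ioo (-h) 0, K r = L₂ (-r))
    (h₁ : Continuous L₁) (h₂ : Continuous L₂) {F : ℝ → ℝ → Matrix (Fin n) (Fin n) ℝ → ℝ}
    (hF : Continuous fun p : (ℝ × ℝ) × Matrix (Fin n) (Fin n) ℝ => F p.1.1 p.1.2 p.2) :
    IsSplitKernel h (fun a b => F a b (K (a - b))) (fun a b => F a b (L₁ (a - b)))
      (fun a b => F a b (L₂ (b - a))) where
  lower a ha b hb hba := by
    rw [hpos (a - b) ⟨sub_pos.2 hba, by linarith [ha.2, hb.1]⟩]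
  upper a ha b hb hab := by
    rw [hneg (a - b) ⟨by linarith [ha.1, hb.2], sub_neg.2 hab⟩, neg_sub]
  continuous_lower := by
    have : Continuous fun p : ℝ × ℝ => (p, L₁ (p.1 - p.2)) :=
      continuous_id.prodMk (h₁.comp (continuous_fst.sub continuous_snd))
    exact hF.comp this
  continuous_upper := by
    have : Continuous fun p : ℝ × ℝ => (p, L₂ (p.2 - p.1)) :=
      continuous_id.prodMk (h₂.comp (continuous_snd.sub continuous_fst))
    exact hF.comp this

theorem continuous_sandwich_bilin {φ : ℝ → Fin n → ℝ} (hφ : Continuous φ)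
    (A B : Matrix (Fin n) (Fin n) ℝ) :
    Continuous fun p : (ℝ × ℝ) × Matrix (Fin n) (Fin n) ℝ =>
      φ p.1.1 ⬝ᵥ (A * p.2 * B) *ᵥ φ p.1.2 :=
  continuous_bilin (hφ.comp (continuous_fst.comp continuous_fst))
    ((continuous_const.matrix_mul continuous_snd).matrix_mul continuous_const)
    (hφ.comp (continuous_snd.comp continuous_fst))

theorem IsExtension.nonneg_Ioo (hE : IsExtension h U V V₁ V₂) : ∀ r ∈ Ioo 0 h, U r = V r :=
  fun r hr => hE.nonneg r (Ioo_subset_Icc_self hr)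

theorem IsExtension.nonpos_Ioo (hE : IsExtension h U V V₁ V₂) :
    ∀ r ∈ Ioo (-h) 0, U r = (V (-r))ᵀ :=
  fun r hr => hE.nonpos r (Ioo_subset_Icc_self hr)

/-- `U` and its derivatives agree with the formulas in `V` away from `0` and `±h`, and the integrals
do not see the exceptional arguments. -/
theorem functional_eq_expanded (hh : 0 < h) (hV : IsSmoothLyapunov h A₀ A₁ D W P V V₁ V₂)
    (hE : IsExtension h U V V₁ V₂) (ξ : Fin n → ℝ) {φ : ℝ → Fin n → ℝ} (hφ : Continuous φ) :
    functional h A₁ D U P ξ φ = expandedFunctional h A₁ D P V V₁ V₂ ξ φ := by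
  have hle : -h ≤ 0 := by linarith
  have hθ : ∀ θ ∈ Ioo (-h) 0, h + θ ∈ Ioo 0 h := fun θ hθ =>
    ⟨by linarith [hθ.1], by linarith [hθ.2]⟩
  have hmix : ∀ {K L : ℝ → Matrix (Fin n) (Fin n) ℝ}, (∀ r ∈ Ioo 0 h, K r = L r) →
      Continuous L → ∀ A : Matrix (Fin n) (Fin n) ℝ,
      ξ ⬝ᵥ (∫ θ in (-h)..0, ((K (h + θ))ᵀ * A) *ᵥ φ θ) =
        ∫ θ in (-h)..0, ξ ⬝ᵥ ((L (h + θ))ᵀ * A) *ᵥ φ θ := by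
    intro K L hKL hL A
    have hc : Continuous fun θ => ((L (h + θ))ᵀ * A) *ᵥ φ θ :=
      ((hL.comp (continuous_const.add continuous_id)).matrix_transpose.matrix_mul
        continuous_const).matrix_mulVec hφ
    rw [← integral_dotProduct_left ξ (hc.intervalIntegrable _ _)]
    congr 1
    refine intervalIntegral.integral_congr_Ioo_of_le hle fun θ h' => ?_
    simp only [hKL _ (hθ θ h')]
  have s0 := isSplitKernel_of_matrix hE.nonneg_Ioo hE.nonpos_Ioo (L₂ := fun r => (V r)ᵀ)
    hV.continuous₀ hV.continuous₀.matrix_transpose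
    (F := fun a b M => φ a ⬝ᵥ (A₁ᵀ * M * A₁) *ᵥ φ b) (continuous_sandwich_bilin hφ A₁ᵀ A₁)
  have s1 := isSplitKernel_of_matrix hE.deriv_pos hE.deriv_neg (L₂ := fun r => -(V₁ r)ᵀ)
    hV.continuous₁ hV.continuous₁.matrix_transpose.neg
    (F := fun a b M => φ a ⬝ᵥ (A₁ᵀ * M * D) *ᵥ φ b) (continuous_sandwich_bilin hφ A₁ᵀ D)
  have s2 := isSplitKernel_of_matrix hE.deriv₂_pos hE.deriv₂_neg (L₂ := fun r => (V₂ r)ᵀ)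
    hV.continuous₂ hV.continuous₂.matrix_transpose
    (F := fun a b M => φ a ⬝ᵥ (Dᵀ * M * D) *ᵥ φ b) (continuous_sandwich_bilin hφ Dᵀ D)
  unfold functional expandedFunctional
  rw [hE.nonneg 0 ⟨le_rfl, hh.le⟩, hmix hE.nonneg_Ioo hV.continuous₀,
    hmix hE.deriv_pos hV.continuous₁, ← s0.integral_square_eq hh, ← s1.integral_square_eq hh,
    ← s2.integral_add_integral_eq hh]
  ring

theorem expanded_eq_smooth (hV : IsSmoothLyapunov h A₀ A₁ D W P V V₁ V₂)
    (ξ : Fin n → ℝ) {φ : ℝ → Fin n → ℝ} (hφ : Continuous φ) :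
    expandedFunctional h A₁ D P V V₁ V₂ ξ φ =
      smoothFunctional h (V 0) (Dᵀ * P * D) (kernelN A₁ D V V₁)
        (kernelLower A₁ D V V₁ V₂) (kernelUpper A₁ D V V₁ V₂) ξ φ := by
  have hmix : ∀ {L : ℝ → Matrix (Fin n) (Fin n) ℝ}, Continuous L →
      ∀ A : Matrix (Fin n) (Fin n) ℝ,
      IntervalIntegrable (fun θ => ξ ⬝ᵥ ((L (h + θ))ᵀ * A) *ᵥ φ θ) volume (-h) 0 :=
    fun hL A => (continuous_bilin continuous_const
      ((hL.comp (continuous_const.add continuous_id)).matrix_transpose.matrix_mul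
        continuous_const) hφ).intervalIntegrable _ _
  have hl : ∀ {L : ℝ → Matrix (Fin n) (Fin n) ℝ}, Continuous L →
      ∀ A B : Matrix (Fin n) (Fin n) ℝ, Continuous (Function.uncurry fun a b =>
        φ a ⬝ᵥ (A * L (a - b) * B) *ᵥ φ b) := fun hL A B =>
    (continuous_bilin (hφ.comp continuous_fst)
      ((continuous_const.matrix_mul (hL.comp (continuous_fst.sub continuous_snd))).matrix_mul
        continuous_const) (hφ.comp continuous_snd))
  have hu : ∀ {L : ℝ → Matrix (Fin n) (Fin n) ℝ}, Continuous L →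
      ∀ A B : Matrix (Fin n) (Fin n) ℝ, Continuous (Function.uncurry fun a b =>
        φ a ⬝ᵥ (A * L (b - a) * B) *ᵥ φ b) := fun hL A B =>
    (continuous_bilin (hφ.comp continuous_fst)
      ((continuous_const.matrix_mul (hL.comp (continuous_snd.sub continuous_fst))).matrix_mul
        continuous_const) (hφ.comp continuous_snd))
  have t0 := hV.continuous₀.matrix_transpose
  have t1 : Continuous fun r => -(V₁ r)ᵀ := hV.continuous₁.matrix_transpose.neg
  have t2 := hV.continuous₂.matrix_transpose
  have e1 : (∫ θ in (-h)..0, ξ ⬝ᵥ kernelN A₁ D V V₁ (h + θ) *ᵥ φ θ) =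
      (∫ θ in (-h)..0, ξ ⬝ᵥ ((V (h + θ))ᵀ * A₁) *ᵥ φ θ) -
        ∫ θ in (-h)..0, ξ ⬝ᵥ ((V₁ (h + θ))ᵀ * D) *ᵥ φ θ := by
    rw [← intervalIntegral.integral_sub (hmix hV.continuous₀ A₁) (hmix hV.continuous₁ D)]
    simp only [kernelN, sub_mulVec, dotProduct_sub]
  have e4 : triInt (-h) 0 (fun a b => φ a ⬝ᵥ kernelLower A₁ D V V₁ V₂ (a - b) *ᵥ φ b)
      (fun a b => φ a ⬝ᵥ kernelUpper A₁ D V V₁ V₂ (b - a) *ᵥ φ b) =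
      triInt (-h) 0 (fun a b => φ a ⬝ᵥ (A₁ᵀ * V (a - b) * A₁) *ᵥ φ b)
        (fun a b => φ a ⬝ᵥ (A₁ᵀ * (V (b - a))ᵀ * A₁) *ᵥ φ b)
      + 2 * triInt (-h) 0 (fun a b => φ a ⬝ᵥ (A₁ᵀ * V₁ (a - b) * D) *ᵥ φ b)
        (fun a b => φ a ⬝ᵥ (A₁ᵀ * -(V₁ (b - a))ᵀ * D) *ᵥ φ b)
      - triInt (-h) 0 (fun a b => φ a ⬝ᵥ (Dᵀ * V₂ (a - b) * D) *ᵥ φ b)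
        (fun a b => φ a ⬝ᵥ (Dᵀ * (V₂ (b - a))ᵀ * D) *ᵥ φ b) := by
    rw [triInt_combination (hl hV.continuous₀ A₁ᵀ A₁) (hu t0 A₁ᵀ A₁) (hl hV.continuous₁ A₁ᵀ D)
      (hu t1 A₁ᵀ D) (hl hV.continuous₂ Dᵀ D) (hu t2 Dᵀ D)]
    congr 1 <;> funext a b
    · simp only [kernelLower, sub_mulVec, add_mulVec, smul_mulVec, dotProduct_sub, dotProduct_add,
        dotProduct_smul, smul_eq_mul]
    · simp only [kernelUpper, sub_mulVec, smul_mulVec, dotProduct_sub, Matrix.mul_neg,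
        Matrix.neg_mul, neg_mulVec, dotProduct_neg, dotProduct_smul, smul_eq_mul]
      ring
  unfold expandedFunctional smoothFunctional
  rw [e1, e4]
  ring

theorem continuous_thetaT (n N : ℕ) : Continuous (thetaT n N) :=
  continuous_matrix fun i p => by
    simp only [thetaT, of_apply]
    fun_prop

theorem continuous_theta (n N : ℕ) : Continuous (theta n N) :=
  (continuous_thetaT n N).matrix_transpose

theorem continuous_sandwich_theta (n N : ℕ) (A B : Matrix (Fin n) (Fin n) ℝ) :
    Continuous fun p : (ℝ × ℝ) × Matrix (Fin n) (Fin n) ℝ =>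
      theta n N p.1.1 * (A * p.2 * B) * thetaT n N p.1.2 :=
  (((continuous_theta n N).comp (continuous_fst.comp continuous_fst)).matrix_mul
    ((continuous_const.matrix_mul continuous_snd).matrix_mul continuous_const)).matrix_mul
    ((continuous_thetaT n N).comp (continuous_snd.comp continuous_fst))

theorem continuous_theta_lower {L : ℝ → Matrix (Fin n) (Fin n) ℝ} (hL : Continuous L) (N : ℕ)
    (A B : Matrix (Fin n) (Fin n) ℝ) : Continuous (Function.uncurry fun a b =>
      theta n N a * (A * L (a - b) * B) * thetaT n N b) :=
  (((continuous_theta n N).comp continuous_fst).matrix_mul ((continuous_const.matrix_mul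
    (hL.comp (continuous_fst.sub continuous_snd))).matrix_mul continuous_const)).matrix_mul
    ((continuous_thetaT n N).comp continuous_snd)

theorem continuous_theta_upper {L : ℝ → Matrix (Fin n) (Fin n) ℝ} (hL : Continuous L) (N : ℕ)
    (A B : Matrix (Fin n) (Fin n) ℝ) : Continuous (Function.uncurry fun a b =>
      theta n N a * (A * L (b - a) * B) * thetaT n N b) :=
  (((continuous_theta n N).comp continuous_fst).matrix_mul ((continuous_const.matrix_mul
    (hL.comp (continuous_snd.sub continuous_fst))).matrix_mul continuous_const)).matrix_mul
    ((continuous_thetaT n N).comp continuous_snd)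

/-- The matrix `∫∫ Θ(a) A K(a - b) B Θ(b)ᵀ`, with kernel `L₁(a - b)` below and `L₂(b - a)` above the
diagonal. -/
def triMatrix (N : ℕ) (h : ℝ) (A B : Matrix (Fin n) (Fin n) ℝ)
    (L₁ L₂ : ℝ → Matrix (Fin n) (Fin n) ℝ) : Matrix (Fin N × Fin n) (Fin N × Fin n) ℝ :=
  Matrix.of fun q r => triInt (-h) 0
    (fun a b => (theta n N a * (A * L₁ (a - b) * B) * thetaT n N b) q r)
    (fun a b => (theta n N a * (A * L₂ (b - a) * B) * thetaT n N b) q r)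

theorem isSplitKernel_theta {K L₁ L₂ : ℝ → Matrix (Fin n) (Fin n) ℝ}
    (hpos : ∀ r ∈ Ioo 0 h, K r = L₁ r) (hneg : ∀ r ∈ Ioo (-h) 0, K r = L₂ (-r))
    (h₁ : Continuous L₁) (h₂ : Continuous L₂) (A B : Matrix (Fin n) (Fin n) ℝ)
    (q r : Fin N × Fin n) :
    IsSplitKernel h (fun a b => (theta n N a * (A * K (a - b) * B) * thetaT n N b) q r)
      (fun a b => (theta n N a * (A * L₁ (a - b) * B) * thetaT n N b) q r)
      (fun a b => (theta n N a * (A * L₂ (b - a) * B) * thetaT n N b) q r) :=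
  isSplitKernel_of_matrix hpos hneg h₁ h₂
    (F := fun a b M => (theta n N a * (A * M * B) * thetaT n N b) q r)
    ((continuous_sandwich_theta n N A B).matrix_elem q r)

theorem J3_eq (hh : 0 < h) (hV : IsSmoothLyapunov h A₀ A₁ D W P V V₁ V₂)
    (hE : IsExtension h U V V₁ V₂) :
    J3 N h A₁ U = triMatrix N h A₁ᵀ A₁ V fun r => (V r)ᵀ := by
  ext q r
  exact (isSplitKernel_theta hE.nonneg_Ioo hE.nonpos_Ioo (L₂ := fun r => (V r)ᵀ)
    hV.continuous₀ hV.continuous₀.matrix_transpose A₁ᵀ A₁ q r).integral_square_eq hh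

theorem J4_eq (hh : 0 < h) (hV : IsSmoothLyapunov h A₀ A₁ D W P V V₁ V₂)
    (hE : IsExtension h U V V₁ V₂) :
    J4 N h A₁ D U = triMatrix N h A₁ᵀ D V₁ fun r => -(V₁ r)ᵀ := by
  ext q r
  exact (isSplitKernel_theta hE.deriv_pos hE.deriv_neg (L₂ := fun r => -(V₁ r)ᵀ)
    hV.continuous₁ hV.continuous₁.matrix_transpose.neg A₁ᵀ D q r).integral_square_eq hh

theorem J5_eq (hh : 0 < h) (hV : IsSmoothLyapunov h A₀ A₁ D W P V V₁ V₂)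
    (hE : IsExtension h U V V₁ V₂) :
    J5 N h D U = triMatrix N h Dᵀ D V₂ fun r => (V₂ r)ᵀ := by
  ext q r
  exact (isSplitKernel_theta hE.deriv₂_pos hE.deriv₂_neg (L₂ := fun r => (V₂ r)ᵀ)
    hV.continuous₂ hV.continuous₂.matrix_transpose Dᵀ D q r).integral_add_eq hh

/-- Transposition exchanges `θ₁` and `θ₂` and transposes the kernel, which swaps the two triangles.
This uses equal outer factors and fails in general for `J₄`. -/
theorem triMatrix_transpose {L : ℝ → Matrix (Fin n) (Fin n) ℝ} (hL : Continuous L)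
    (A : Matrix (Fin n) (Fin n) ℝ) :
    (triMatrix N h Aᵀ A L fun r => (L r)ᵀ)ᵀ = triMatrix N h Aᵀ A L fun r => (L r)ᵀ := by
  ext q r
  have hswap := triInt_swap
    (k₁ := fun a b => (theta n N a * (Aᵀ * L (a - b) * A) * thetaT n N b) r q)
    (k₂ := fun a b => (theta n N a * (Aᵀ * (L (b - a))ᵀ * A) * thetaT n N b) r q)
    ((continuous_theta_lower hL N Aᵀ A).matrix_elem r q)
    ((continuous_theta_upper hL.matrix_transpose N Aᵀ A).matrix_elem r q) (-h) 0
  have key : ∀ (a b : ℝ) (M : Matrix (Fin n) (Fin n) ℝ),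
      (theta n N b * (Aᵀ * M * A) * thetaT n N a) r q =
        (theta n N a * (Aᵀ * Mᵀ * A) * thetaT n N b) q r := by
    intro a b M
    rw [← transpose_apply (theta n N b * (Aᵀ * M * A) * thetaT n N a)]
    simp only [theta, transpose_mul, transpose_transpose, Matrix.mul_assoc]
  refine hswap.trans ?_
  unfold triMatrix
  rw [of_apply]
  congr 1 <;> funext a b
  · exact (key a b _).trans (by rw [transpose_transpose])
  · exact key a b _

theorem dotProduct_triMatrix_mulVec {L₁ L₂ : ℝ → Matrix (Fin n) (Fin n) ℝ} (h₁ : Continuous L₁)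
    (h₂ : Continuous L₂) (A B : Matrix (Fin n) (Fin n) ℝ) (Φ : Fin N × Fin n → ℝ) :
    Φ ⬝ᵥ triMatrix N h A B L₁ L₂ *ᵥ Φ =
      triInt (-h) 0
        (fun a b => (thetaT n N a *ᵥ Φ) ⬝ᵥ (A * L₁ (a - b) * B) *ᵥ (thetaT n N b *ᵥ Φ))
        (fun a b => (thetaT n N a *ᵥ Φ) ⬝ᵥ (A * L₂ (b - a) * B) *ᵥ (thetaT n N b *ᵥ Φ)) := by
  refine (dotProduct_triInt_mulVec
    (K₁ := fun a b => theta n N a * (A * L₁ (a - b) * B) * thetaT n N b)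
    (K₂ := fun a b => theta n N a * (A * L₂ (b - a) * B) * thetaT n N b)
    (continuous_theta_lower h₁ N A B) (continuous_theta_upper h₂ N A B)
    Φ Φ (-h) 0).trans ?_
  simp only [bilin_left, mulVec_mulVec, theta, Matrix.mul_assoc]

theorem dotProduct_J1_J2 {K L : ℝ → Matrix (Fin n) (Fin n) ℝ} (hh : 0 < h)
    (hKL : ∀ r ∈ Ioo 0 h, K r = L r) (hL : Continuous L) (A : Matrix (Fin n) (Fin n) ℝ)
    (ξ : Fin n → ℝ) (Φ : Fin N × Fin n → ℝ) :
    ξ ⬝ᵥ (Matrix.of fun i q => ∫ θ in (-h)..0, ((K (h + θ))ᵀ * A * thetaT n N θ) i q) *ᵥ Φ =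
      ∫ θ in (-h)..0, ξ ⬝ᵥ ((L (h + θ))ᵀ * A) *ᵥ (thetaT n N θ *ᵥ Φ) := by
  have e : (Matrix.of fun i q => ∫ θ in (-h)..0, ((K (h + θ))ᵀ * A * thetaT n N θ) i q) =
      Matrix.of fun i q => ∫ θ in (-h)..0, ((L (h + θ))ᵀ * A * thetaT n N θ) i q := by
    ext i q
    refine intervalIntegral.integral_congr_Ioo_of_le (by linarith) fun θ hθ => ?_
    simp only [hKL (h + θ) ⟨by linarith [hθ.1], by linarith [hθ.2]⟩]
  rw [e]
  refine (dotProduct_integral_mulVec (M := fun θ => (L (h + θ))ᵀ * A * thetaT n N θ)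
    (((hL.comp (continuous_const.add continuous_id)).matrix_transpose.matrix_mul
      continuous_const).matrix_mul (continuous_thetaT n N)) ξ Φ (-h) 0).trans ?_
  simp only [mulVec_mulVec]

theorem dotProduct_J6 (ξ : Fin N × Fin n → ℝ) :
    ξ ⬝ᵥ J6 N h D P *ᵥ ξ =
      ∫ θ in (-h)..0, (thetaT n N θ *ᵥ ξ) ⬝ᵥ (Dᵀ * P * D) *ᵥ (thetaT n N θ *ᵥ ξ) := by
  refine (dotProduct_integral_mulVec (M := fun θ => theta n N θ * (Dᵀ * P * D) * thetaT n N θ)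
    (((continuous_theta n N).matrix_mul continuous_const).matrix_mul (continuous_thetaT n N))
    ξ ξ (-h) 0).trans ?_
  simp only [bilin_left, mulVec_mulVec, theta, Matrix.mul_assoc]

theorem continuous_thetaT_mulVec (Φ : Fin N × Fin n → ℝ) :
    Continuous fun θ => thetaT n N θ *ᵥ Φ :=
  (continuous_thetaT n N).matrix_mulVec continuous_const

/-- Each block reproduces one group of terms. The off-diagonal blocks account for the factor `2` in
the mixed term, and `J₄ + J₄ᵀ` for the factor `2` in front of the `U'` term. -/
theorem PMat_eq_expanded (hh : 0 < h) (hV : IsSmoothLyapunov h A₀ A₁ D W P V V₁ V₂)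
    (hE : IsExtension h U V V₁ V₂) (ξ : Fin n → ℝ) (Φ : Fin N × Fin n → ℝ) :
    Xi ξ Φ ⬝ᵥ PMat N h A₁ D U P *ᵥ Xi ξ Φ =
      expandedFunctional h A₁ D P V V₁ V₂ ξ fun θ => thetaT n N θ *ᵥ Φ := by
  have j1 : ξ ⬝ᵥ J1 N h A₁ U *ᵥ Φ = _ :=
    dotProduct_J1_J2 hh hE.nonneg_Ioo hV.continuous₀ A₁ ξ Φ
  have j2 : ξ ⬝ᵥ J2 N h D U *ᵥ Φ = _ :=
    dotProduct_J1_J2 hh hE.deriv_pos hV.continuous₁ D ξ Φ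
  have t0 := hV.continuous₀.matrix_transpose
  have t1 : Continuous fun r => -(V₁ r)ᵀ := hV.continuous₁.matrix_transpose.neg
  have t2 := hV.continuous₂.matrix_transpose
  have j3 := dotProduct_triMatrix_mulVec (h := h) hV.continuous₀ t0 A₁ᵀ A₁ Φ
  have j4 := dotProduct_triMatrix_mulVec (h := h) hV.continuous₁ t1 A₁ᵀ D Φ
  have j5 := dotProduct_triMatrix_mulVec (h := h) hV.continuous₂ t2 Dᵀ D Φ
  rw [← J3_eq hh hV hE] at j3
  rw [← J4_eq hh hV hE] at j4
  rw [← J5_eq hh hV hE] at j5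
  unfold expandedFunctional
  rw [← j1, ← j2, ← j3, ← j4, ← j5, ← dotProduct_J6, ← hE.nonneg 0 ⟨le_rfl, hh.le⟩]
  simp only [Xi, PMat, fromBlocks_mulVec, Sum.elim_comp_inl, Sum.elim_comp_inr,
    sumElim_dotProduct_sumElim, dotProduct_add, sub_mulVec, add_mulVec, dotProduct_sub,
    transpose_sub, ← bilin_swap _ ξ Φ, ← bilin_swap _ Φ Φ]
  ring

theorem PMat_isHermitian (hh : 0 < h) (hV : IsSmoothLyapunov h A₀ A₁ D W P V V₁ V₂)
    (hE : IsExtension h U V V₁ V₂) : (PMat N h A₁ D U P).IsHermitian := by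
  have hP : Pᵀ = P := by
    rw [← hV.jump, transpose_add, transpose_transpose, add_comm]
  have h6 : (J6 N h D P)ᵀ = J6 N h D P := by
    ext q r
    refine intervalIntegral.integral_congr fun θ _ => ?_
    rw [← transpose_apply (theta n N θ * (Dᵀ * P * D) * thetaT n N θ)]
    simp only [theta, transpose_mul, transpose_transpose, Matrix.mul_assoc, hP]
  have h3 : (J3 N h A₁ U)ᵀ = J3 N h A₁ U := by
    rw [J3_eq hh hV hE, triMatrix_transpose hV.continuous₀]
  have h5 : (J5 N h D U)ᵀ = J5 N h D U := by
    rw [J5_eq hh hV hE, triMatrix_transpose hV.continuous₂]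
  rw [IsHermitian, conjTranspose_eq_transpose_of_trivial, PMat, fromBlocks_transpose,
    transpose_transpose, hE.nonneg 0 ⟨le_rfl, hh.le⟩, hV.symm_zero]
  congr 1
  simp only [transpose_sub, transpose_add, transpose_transpose, h3, h5, h6]
  abel

theorem contDiff_thetaT_mulVec (Φ : Fin N × Fin n → ℝ) :
    ContDiff ℝ 1 fun θ => thetaT n N θ *ᵥ Φ := by
  refine contDiff_pi.2 fun i => ?_
  simp only [mulVec, dotProduct, thetaT, of_apply]
  fun_prop

theorem PMat_posSemidef (hh : 0 < h) (hW : W.PosDef) (hs : ExpStable h A₀ A₁ D)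
    (hV : IsSmoothLyapunov h A₀ A₁ D W P V V₁ V₂) (hE : IsExtension h U V V₁ V₂) :
    (PMat N h A₁ D U P).PosSemidef := by
  refine .of_dotProduct_mulVec_nonneg (PMat_isHermitian hh hV hE) fun v => ?_
  -- A general vector has a first block unrelated to its second, which is why nonnegativity is
  -- needed for all `ξ` and not only for `φ(0) - D φ(-h)`.
  have hv : v = Xi (v ∘ Sum.inl) (v ∘ Sum.inr) := (Sum.elim_comp_inl_inr v).symm
  rw [star_trivial, hv, PMat_eq_expanded hh hV hE,
    expanded_eq_smooth hV _ (continuous_thetaT_mulVec _)]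
  exact hV.nonneg hh hW hs _ (contDiff_thetaT_mulVec _)

/-- The degree bound lets each `p j` be written with its first `N` coefficients; exchanging the two
sums gives the monomial form. -/
theorem polyApprox_eq_thetaT_mulVec {p : Fin N → Polynomial ℝ}
    (hp : ∀ k, (p k).degree < (N : WithBot ℕ)) (Q : Fin N × Fin n → ℝ) (θ : ℝ) :
    polyApprox p Q θ = thetaT n N θ *ᵥ monomialCoeffs p Q := by
  have hev : ∀ j, (p j).eval θ = ∑ k : Fin N, (p j).coeff k * θ ^ (k : ℕ) := fun j => by
    rw [Polynomial.eval_eq_sum]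
    exact (Polynomial.sum_fin _ (by simp) (hp j)).symm
  ext i
  simp only [polyApprox, polyT, mulVec, dotProduct, thetaT, monomialCoeffs, of_apply, one_apply,
    mul_ite, mul_one, mul_zero, ite_mul, zero_mul, Fintype.sum_prod_type, Finset.sum_ite_eq,
    Finset.mem_univ, if_true]
  simp only [hev, Finset.sum_mul, Finset.mul_sum]
  rw [Finset.sum_comm]
  exact Finset.sum_congr rfl fun k _ => Finset.sum_congr rfl fun j _ => by ring

end QuadraticForm

end

end NeutralDelay

/-! ### The theorem -/

theorem mainTheorem3 {n : ℕ} (h : ℝ) (hh : 0 < h)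
    (A₀ A₁ D W : Matrix (Fin n) (Fin n) ℝ) (hW : W.PosDef)
    (U : ℝ → Matrix (Fin n) (Fin n) ℝ) (P : Matrix (Fin n) (Fin n) ℝ)
    (hU : NeutralDelay.IsDelayLyapunovMatrix h A₀ A₁ D W U P)
    (hstab : NeutralDelay.ExpStable h A₀ A₁ D) (N : ℕ) :
    (NeutralDelay.PMat N h A₁ D U P).PosSemidef ∧
    ∀ (p : Fin N → Polynomial ℝ), (∀ k, (p k).degree < (N : WithBot ℕ)) →
      ∀ Q : Fin N × Fin n → ℝ,
        (∀ θ : ℝ, NeutralDelay.polyApprox p Q θ =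
          NeutralDelay.thetaT n N θ *ᵥ NeutralDelay.monomialCoeffs p Q) ∧
        (NeutralDelay.v0 h A₁ D U P (NeutralDelay.polyApprox p Q) =
          NeutralDelay.Xi (NeutralDelay.polyApprox p Q 0 - D *ᵥ NeutralDelay.polyApprox p Q (-h))
              (NeutralDelay.monomialCoeffs p Q) ⬝ᵥ
            NeutralDelay.PMat N h A₁ D U P *ᵥ
            NeutralDelay.Xi (NeutralDelay.polyApprox p Q 0 - D *ᵥ NeutralDelay.polyApprox p Q (-h))
              (NeutralDelay.monomialCoeffs p Q)) ∧
        ∀ φ : ℝ → Fin n → ℝ, NeutralDelay.IsPC1On φ (-h) 0 →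
          NeutralDelay.functional h A₁ D U P (φ 0 - D *ᵥ φ (-h)) (NeutralDelay.polyApprox p Q) =
            NeutralDelay.Xi (φ 0 - D *ᵥ φ (-h)) (NeutralDelay.monomialCoeffs p Q) ⬝ᵥ
              NeutralDelay.PMat N h A₁ D U P *ᵥ
              NeutralDelay.Xi (φ 0 - D *ᵥ φ (-h)) (NeutralDelay.monomialCoeffs p Q) := by
  obtain ⟨V, V₁, V₂, hV, hE⟩ := hU.exists_smooth hh hstab
  -- With `ξ` free, this one identity covers both `v₀(φ_N)` and the variant in which `ξ` comes from
  -- the original `φ`.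
  have hquad : ∀ (ξ : Fin n → ℝ) (Φ : Fin N × Fin n → ℝ),
      NeutralDelay.functional h A₁ D U P ξ (fun θ => NeutralDelay.thetaT n N θ *ᵥ Φ) =
        NeutralDelay.Xi ξ Φ ⬝ᵥ NeutralDelay.PMat N h A₁ D U P *ᵥ NeutralDelay.Xi ξ Φ := fun ξ Φ => by
    rw [NeutralDelay.functional_eq_expanded hh hV hE ξ (NeutralDelay.continuous_thetaT_mulVec Φ),
      NeutralDelay.PMat_eq_expanded hh hV hE]
  refine ⟨NeutralDelay.PMat_posSemidef hh hW hstab hV hE, fun p hp Q => ?_⟩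
  have hpoly := NeutralDelay.polyApprox_eq_thetaT_mulVec hp Q
  have hfun : NeutralDelay.polyApprox p Q = fun θ =>
      NeutralDelay.thetaT n N θ *ᵥ NeutralDelay.monomialCoeffs p Q := funext hpoly
  refine ⟨hpoly, ?_, fun φ _ => ?_⟩
  · rw [← hquad, ← hfun, NeutralDelay.v0]
  · rw [← hquad, ← hfun]
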